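/- **Conventions.** Formulas are first-order formulas with equality (a logical symbol) over a countable signature and countably many variables; $\mathit{vars}(\varphi)$ is the set of variables of $\varphi$. A theory $\mathcal T$ is given by a set of sentences (axioms); a $\mathcal T$-interpretation is a structure with nonempty domain satisfying the axioms, together with a value for every variable. $\mathcal T$ is *decidable* if the set of $\mathcal T$-satisfiable quantifier-free formulas is decidable. For theories over disjoint signatures, $\mathcal T_1\oplus\mathcal T_2$ is the theory over the union of the signatures axiomatized by the union of the axioms. $\mathcal T$ is *smooth* if for every quantifier-free $\varphi$, every $\mathcal T$-interpretation $\mathcal A$ satisfying $\varphi$ and every cardinal $\kappa>|\mathrm{dom}(\mathcal A)|$ there is a $\mathcal T$-interpretation satisfying $\varphi$ with domain of cardinality $\kappa$. The *arrangement* $\delta_V$ on a finite set $V$ of variables induced by an equivalence relation $E$ on $V$ is the conjunction, over $x,y\in V$, of $x=y$ if $x\mathrel Ey$ and of $\neg(x=y)$ otherwise. A *strong witness* for $\mathcal T$ is a function $\mathit{wit}$ from quantifier-free formulas to quantifier-free formulas such that for every quantifier-free $\varphi$: (I) $\varphi$ and $\exists\vec x\,\mathit{wit}(\varphi)$, where $\vec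 x=\mathit{vars}(\mathit{wit}(\varphi))\setminus\mathit{vars}(\varphi)$, are satisfied by the same $\mathcal T$-interpretations; (II) if $\mathit{wit}(\varphi)$ is $\mathcal T$-satisfiable, then some $\mathcal T$-interpretation satisfying it has as domain exactly the set of values of the variables of $\mathit{wit}(\varphi)$; (II$'$) for every arrangement $\delta_V$ on a finite set of variables, if $\mathit{wit}(\varphi)\wedge\delta_V$ is $\mathcal T$-satisfiable, then some $\mathcal T$-interpretation satisfying it has as domain exactly the set of values of the variables of $\mathit{wit}(\varphi)\wedge\delta_V$. $\mathcal T$ is *strongly finitely witnessable* if it has a computable strong witness. **The theories.** $\mathcal T_=$ is the theory, over the signature with $0$-ary predicate symbols $P_1,P_2,\dots$ and no function symbols, with axioms $P_n\to\psi_{=n}$ for $n\ge1$, where $\psi_{=n}$ says that the domain has exactly $n$ elements. Call $f:\{1,2,\dots\}\to\{0,1\}$ *admissible* if $f$ is not computable, $f(1)=1$, and for every $k\ge1$ exactly half of the numbers in $\{1,\dots,2^k\}$ are mapped to $1$. Let $f_b(k)$ be the number of $i\in\{1,\dots,k\}$ with $f(i)=b$. $\mathcal T_f$ is the theory, over the signature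 with a single unary function symbol $s$ and no predicate symbols, with axioms $$\bigl[\psi^{=}_{\ge f_1(k)}\wedge\psi^{\neq}_{\ge f_0(k)}\bigr]\vee\bigvee_{i=1}^{k}\bigl[\psi^{=}_{=f_1(i)}\wedge\psi^{\neq}_{=f_0(i)}\bigr]\qquad(k\ge1),$$ where $\psi^{=}_{\ge n}$ and $\psi^{=}_{=n}$ say that at least, respectively exactly, $n$ elements $x$ satisfy $s(x)=x$, and $\psi^{\neq}_{\ge n}$ and $\psi^{\neq}_{=n}$ say the same with $s(x)\ne x$. **The function $\mathit{wit}_=$.** For a quantifier-free formula $\varphi$ over the signature of $\mathcal T_=$, let $c_1\vee\dots\vee c_r$ be the disjunctive normal form of $\varphi$ obtained by distributing (each $c_j$ a conjunction of literals), and let $w_1,w_2,\dots$ be variables that are not in $\mathit{vars}(\varphi)$. Put $$\mathit{wit}_=(\varphi)=\bigvee_{j=1}^r\Bigl(c_j\wedge w_1=w_1\wedge\bigwedge_{1\le a<b\le n_j}\neg(w_a=w_b)\Bigr),$$ where $n_j$ is the largest $n$ such that the literal $P_n$ is in $c_j$, and $n_j=0$ if there is none. **Theorem.** Admissible functions exist.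 $\mathcal T_=$ is decidable, is strongly finitely witnessable, with the computable strong witness $\mathit{wit}_=$, and is not smooth. For every admissible $f$, the theory $\mathcal T_f$ is decidable, and $\mathcal T_f\oplus\mathcal T_=$ is undecidable. Consequently there are decidable theories $\mathcal T_1=\mathcal T_f$ and $\mathcal T_2=\mathcal T_=$ over disjoint signatures such that $\mathcal T_2$ is strongly finitely witnessable but $\mathcal T_1\oplus\mathcal T_2$ is undecidable: smoothness cannot be dropped from the theorem that $\mathcal T_1\oplus\mathcal T_2$ is decidable whenever $\mathcal T_1,\mathcal T_2$ are decidable over disjoint signatures and $\mathcal T_2$ is smooth and strongly finitely witnessable. -/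

import Mathlib

open FirstOrder FirstOrder.Language

namespace TheoryCombination

/-! ### Interpretations, satisfiability, Gödel numbers, decidable theories

Equality is a logical symbol in Mathlib's first-order logic, so a signature is a
`FirstOrder.Language`. The variables are the natural numbers, so formulas are terms of type
`L.Formula ℕ`. Theories are given by their axioms. -/

/-- A `T`-interpretation: a structure satisfying the axioms of `T`, with a value for every
variable. The domain is nonempty because the variables take values in it. -/
structure Interp {L : FirstOrder.Language.{0, 0}} (T : L.Theory) where
  /-- The domain. -/
  Dom : Type
  /-- The meaning of the function and predicate symbols. -/
  [str : L.Structure Dom]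
  /-- The values of the variables. -/
  val : ℕ → Dom
  /-- The axioms hold. -/
  models : Dom ⊨ T

attribute [instance] Interp.str

/-- `A ⊨ φ`. -/
def Interp.Sat {L : FirstOrder.Language.{0, 0}} {T : L.Theory} (A : Interp T) (φ : L.Formula ℕ) : Prop :=
  φ.Realize A.val

/-- `φ` is `T`-satisfiable. -/
def Satisfiable {L : FirstOrder.Language.{0, 0}} (T : L.Theory) (φ : L.Formula ℕ) : Prop :=
  ∃ A : Interp T, A.Sat φ

/-- `φ` is quantifier-free. -/
abbrev QF {L : FirstOrder.Language.{0, 0}} (φ : L.Formula ℕ) : Prop := BoundedFormula.IsQF φ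

/-- The set of variables of a quantifier-free formula (all of them are free). -/
def vars {L : FirstOrder.Language.{0, 0}} (φ : L.Formula ℕ) : Finset ℕ := BoundedFormula.freeVarFinset φ

/-- A numbering of the symbols of a signature (separately for each arity and kind). -/
class SymbolCoding (L : FirstOrder.Language.{0, 0}) where
  /-- The number of a function symbol. -/
  funCode : ∀ {k : ℕ}, L.Functions k → ℕ
  /-- The number of a predicate symbol. -/
  relCode : ∀ {k : ℕ}, L.Relations k → ℕ
  funCode_injective : ∀ k : ℕ, Function.Injective (funCode : L.Functions k → ℕ)
  relCode_injective : ∀ k : ℕ, Function.Injective (relCode : L.Relations k → ℕ)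

/-- The Gödel number of a term. -/
def termCode {L : FirstOrder.Language.{0, 0}} [SymbolCoding L] {n : ℕ} : L.Term (ℕ ⊕ Fin n) → ℕ
  | .var (Sum.inl i) => 3 * i
  | .var (Sum.inr j) => 3 * (j : ℕ) + 1
  | .func (l := k) g ts =>
      3 * Nat.pair (Nat.pair k (SymbolCoding.funCode g))
        (Encodable.encode (List.ofFn fun i => termCode (ts i))) + 2

/-- The Gödel number of a formula. -/
def formulaCode {L : FirstOrder.Language.{0, 0}} [SymbolCoding L] : ∀ {n : ℕ}, L.BoundedFormula ℕ n → ℕ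
  | _, .falsum => 0
  | _, .equal t u => 4 * Nat.pair (termCode t) (termCode u) + 1
  | _, .rel (l := k) R ts =>
      4 * Nat.pair (Nat.pair k (SymbolCoding.relCode R))
        (Encodable.encode (List.ofFn fun i => termCode (ts i))) + 2
  | _, .imp φ ψ => 4 * Nat.pair (formulaCode φ) (formulaCode ψ) + 3
  | _, .all φ => 4 * formulaCode φ + 4

/-- `T` is decidable: the set of `T`-satisfiable quantifier-free formulas is decidable. -/
def DecidableTheory {L : FirstOrder.Language.{0, 0}} [SymbolCoding L] (T : L.Theory) : Prop :=
  ComputablePred fun c : ℕ => ∃ φ : L.Formula ℕ, QF φ ∧ formulaCode φ = c ∧ Satisfiable T φ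

/-- The map `w` on quantifier-free formulas is computable. -/
def ComputableOnQF {L : FirstOrder.Language.{0, 0}} [SymbolCoding L] (w : L.Formula ℕ → L.Formula ℕ) : Prop :=
  ∃ g : ℕ → ℕ, Computable g ∧ ∀ φ : L.Formula ℕ, QF φ → g (formulaCode φ) = formulaCode (w φ)

/-! ### Combinations -/

/-- The numbering of the symbols of the disjoint union of two signatures. -/
instance sumCoding (L₁ L₂ : FirstOrder.Language.{0, 0}) [SymbolCoding L₁] [SymbolCoding L₂] :
    SymbolCoding (L₁.sum L₂) where
  funCode := Sum.elim (fun g => 2 * SymbolCoding.funCode g)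
    (fun g => 2 * SymbolCoding.funCode g + 1)
  relCode := Sum.elim (fun R => 2 * SymbolCoding.relCode R)
    (fun R => 2 * SymbolCoding.relCode R + 1)
  funCode_injective k := by
    rintro (a | a) (b | b) h <;> simp only [Sum.elim_inl, Sum.elim_inr] at h
    · exact congrArg _ (SymbolCoding.funCode_injective k (by omega))
    · omega
    · omega
    · exact congrArg _ (SymbolCoding.funCode_injective k (by omega))
  relCode_injective k := by
    rintro (a | a) (b | b) h <;> simp only [Sum.elim_inl, Sum.elim_inr] at h
    · exact congrArg _ (SymbolCoding.relCode_injective k (by omega))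
    · omega
    · omega
    · exact congrArg _ (SymbolCoding.relCode_injective k (by omega))

/-- `T₁ ⊕ T₂`: the theory over the union of the two disjoint signatures that is axiomatized by the
axioms of `T₁` and those of `T₂`. -/
def combination {L₁ L₂ : FirstOrder.Language.{0, 0}} (T₁ : L₁.Theory) (T₂ : L₂.Theory) :
    (L₁.sum L₂).Theory :=
  (LHom.sumInl : L₁ →ᴸ L₁.sum L₂).onTheory T₁ ∪ (LHom.sumInr : L₂ →ᴸ L₁.sum L₂).onTheory T₂

/-! ### Smoothness and strong finite witnessability -/

/-- `T` is smooth. -/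
def Smooth {L : FirstOrder.Language.{0, 0}} (T : L.Theory) : Prop :=
  ∀ φ : L.Formula ℕ, QF φ → ∀ A : Interp T, A.Sat φ → ∀ κ : Cardinal.{0}, Cardinal.mk A.Dom < κ →
    ∃ B : Interp T, B.Sat φ ∧ Cardinal.mk B.Dom = κ

/-- The conjunction of a list of formulas. -/
def bigAnd {L : FirstOrder.Language.{0, 0}} (l : List (L.Formula ℕ)) : L.Formula ℕ :=
  l.foldr (· ⊓ ·) ⊤

/-- The disjunction of a list of formulas. -/
def bigOr {L : FirstOrder.Language.{0, 0}} (l : List (L.Formula ℕ)) : L.Formula ℕ :=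
  l.foldr (· ⊔ ·) ⊥

/-- The equation `x = y` between two variables. -/
def eqVar {L : FirstOrder.Language.{0, 0}} {α : Type} (x y : α) : L.Formula α :=
  Term.equal (Term.var x) (Term.var y)

open Classical in
/-- The arrangement on `V` induced by the equivalence relation `E` on `V`. -/
noncomputable def arrangement {L : FirstOrder.Language.{0, 0}} (V : Finset ℕ) (E : Setoid V) : L.Formula ℕ :=
  bigAnd ((Finset.univ : Finset (V × V)).toList.map fun p =>
    if E p.1 p.2 then eqVar (p.1 : ℕ) (p.2 : ℕ) else ∼(eqVar (p.1 : ℕ) (p.2 : ℕ)))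

/-- The domain of `A` is the set of values of the variables of `φ`. -/
def Interp.Minimal {L : FirstOrder.Language.{0, 0}} {T : L.Theory} (A : Interp T) (φ : L.Formula ℕ) : Prop :=
  ∀ a : A.Dom, ∃ x ∈ vars φ, A.val x = a

/-- `wit` is a witness for `T`. In `equiv`, the right-hand side says that `A` satisfies
`∃ x⃗, wit φ`, where `x⃗ = vars (wit φ) \ vars φ`. -/
structure IsWitness {L : FirstOrder.Language.{0, 0}} (T : L.Theory) (wit : L.Formula ℕ → L.Formula ℕ) :
    Prop where
  qf : ∀ φ, QF φ → QF (wit φ)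
  equiv : ∀ φ, QF φ → ∀ A : Interp T, A.Sat φ ↔
    ∃ v : ℕ → A.Dom, (∀ x, x ∉ vars (wit φ) \ vars φ → v x = A.val x) ∧ (wit φ).Realize v
  minimal : ∀ φ, QF φ → Satisfiable T (wit φ) →
    ∃ A : Interp T, A.Sat (wit φ) ∧ A.Minimal (wit φ)

/-- `wit` is a strong witness for `T`. -/
structure IsStrongWitness {L : FirstOrder.Language.{0, 0}} (T : L.Theory)
    (wit : L.Formula ℕ → L.Formula ℕ) : Prop extends IsWitness T wit where
  strong : ∀ φ, QF φ → ∀ (V : Finset ℕ) (E : Setoid V),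
    Satisfiable T (wit φ ⊓ arrangement V E) →
    ∃ A : Interp T, A.Sat (wit φ ⊓ arrangement V E) ∧ A.Minimal (wit φ ⊓ arrangement V E)

/-- `T` is strongly finitely witnessable (with a computable strong witness). -/
def StronglyFinitelyWitnessable {L : FirstOrder.Language.{0, 0}} [SymbolCoding L] (T : L.Theory) : Prop :=
  ∃ wit : L.Formula ℕ → L.Formula ℕ, ComputableOnQF wit ∧ IsStrongWitness T wit

/-! ### Cardinality formulas -/

/-- `⋀_{i < j} ¬ (x i = x j)` for variables `x 0, …, x (n-1)`. -/
noncomputable def distinct {L : FirstOrder.Language.{0, 0}} {α : Type} {n : ℕ} (x : Fin n → α) :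
    L.Formula α :=
  Formula.iInf fun p : {p : Fin n × Fin n // p.1 < p.2} => ∼(eqVar (x p.1.1) (x p.1.2))

/-- `ψ_{≥ n}`. -/
noncomputable def psiGe (L : FirstOrder.Language.{0, 0}) (n : ℕ) : L.Sentence :=
  Formula.iExs (Fin n) (distinct fun i => Sum.inr i)

/-- `ψ_{≤ n}`: `∃ x₁ … xₙ, ∀ y, ⋁ i, y = xᵢ`. -/
noncomputable def psiLe (L : FirstOrder.Language.{0, 0}) (n : ℕ) : L.Sentence :=
  Formula.iExs (Fin n) (Formula.iAlls Unit
    (Formula.iSup fun i : Fin n => eqVar (Sum.inr ()) (Sum.inl (Sum.inr i))))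

/-- `ψ_{= n}`. -/
noncomputable def psiEq (L : FirstOrder.Language.{0, 0}) (n : ℕ) : L.Sentence := psiGe L n ⊓ psiLe L n

/-! ### The theory `T_=` -/

/-- The predicate symbols `P₁, P₂, …`, all of arity `0`. -/
inductive PRel : ℕ → Type
  | P (n : ℕ+) : PRel 0

/-- The index of a predicate symbol. -/
def PRel.index : ∀ {k : ℕ}, PRel k → ℕ
  | _, .P n => n

/-- The signature with the propositional symbols `P₁, P₂, …` and no function symbols. -/
def SigP : FirstOrder.Language.{0, 0} := ⟨fun _ => Empty, PRel⟩

instance : SymbolCoding SigP where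
  funCode := Empty.elim
  relCode := PRel.index
  funCode_injective _ := fun a => Empty.elim a
  relCode_injective k := by
    rintro ⟨m⟩ ⟨n⟩ h
    exact congrArg PRel.P (PNat.eq h)

/-- `P n` as a symbol of the signature. -/
def symP (n : ℕ+) : SigP.Relations 0 := PRel.P n

/-- The atomic sentence `P n`. -/
def atomP {α : Type} (n : ℕ+) : SigP.Formula α := (symP n).formula Fin.elim0

/-- `T_=`, axiomatized by `P n → ψ_{= n}` for `n ≥ 1`. -/
noncomputable def theoryEq : SigP.Theory :=
  Set.range fun n : ℕ+ => (atomP n : SigP.Sentence).imp (psiEq SigP n)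

/-! ### The strong witness for `T_=` -/

/-- A literal: an atomic formula together with its sign. -/
abbrev Lit (L : FirstOrder.Language.{0, 0}) := Bool × L.Formula ℕ

/-- The formula denoted by a literal. -/
def Lit.toFormula {L : FirstOrder.Language.{0, 0}} (l : Lit L) : L.Formula ℕ :=
  if l.1 then l.2 else ∼l.2

/-- A disjunctive normal form of `φ` (for `b = true`), respectively of `¬ φ` (for `b = false`), as
a list of cubes, each of them a list of literals. The value at quantified formulas is irrelevant. -/
def dnf {L : FirstOrder.Language.{0, 0}} : ∀ {n : ℕ}, L.BoundedFormula ℕ n → Bool →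
    List (List (Bool × L.BoundedFormula ℕ n))
  | _, .falsum, true => []
  | _, .falsum, false => [ [] ]
  | _, .equal t u, b => [ [(b, .equal t u)] ]
  | _, .rel R ts, b => [ [(b, .rel R ts)] ]
  | _, .imp φ ψ, true => dnf φ false ++ dnf ψ true
  | _, .imp φ ψ, false => (dnf φ true).flatMap fun c => (dnf ψ false).map fun d => c ++ d
  | _, .all _, _ => []

/-- `n` for the literal `P n`, and `0` for every other literal. -/
def Lit.posIndex : Lit SigP → ℕ
  | (true, .rel R _) => PRel.index R
  | _ => 0

/-- The largest `n` such that the literal `P n` is in the cube `c`, and `0` if there is none. -/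
def maxPosIndex (c : List (Lit SigP)) : ℕ := (c.map Lit.posIndex).foldr max 0

/-- The least `k` such that `k, k + 1, …` are not variables of `φ`. -/
def freshIndex {L : FirstOrder.Language.{0, 0}} (φ : L.Formula ℕ) : ℕ := (vars φ).sup Nat.succ

/-- The strong witness on a cube `c`, with fresh variables `wᵢ = k + i`, `i = 0, 1, …`:
it is `c ∧ w₀ = w₀ ∧ ⋀_{i < j < n} ¬ (wᵢ = wⱼ)`, where `n` is the largest number such that the
literal `P n` is in `c` (and `n = 0`, so that the last conjunct is empty, if there is none). -/
def cubeWit (k : ℕ) (c : List (Lit SigP)) : SigP.Formula ℕ :=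
  bigAnd (c.map Lit.toFormula) ⊓ (eqVar k k ⊓
    bigAnd ((List.range (maxPosIndex c)).flatMap fun j =>
      (List.range j).map fun i => ∼(eqVar (k + i) (k + j))))

/-- The strong witness: the disjunction of the witnesses of the cubes of a disjunctive normal
form. -/
def witEq (φ : SigP.Formula ℕ) : SigP.Formula ℕ :=
  bigOr ((dnf φ true).map (cubeWit (freshIndex φ)))

/-! ### The theory `T_f` -/

/-- The unary function symbol `s`. -/
inductive SFunc : ℕ → Type
  | s : SFunc 1

/-- The signature with one unary function symbol `s` and no predicate symbols. -/
def SigS : FirstOrder.Language.{0, 0} := ⟨SFunc, fun _ => Empty⟩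

instance : SymbolCoding SigS where
  funCode := fun _ => 0
  relCode := Empty.elim
  funCode_injective k := by
    rintro ⟨⟩ ⟨⟩ _
    rfl
  relCode_injective _ := fun a => Empty.elim a

/-- `s` as a symbol of the signature. -/
def symS : SigS.Functions 1 := SFunc.s

/-- `p x`, that is `s x = x`, for `b = true`; `¬ p x` for `b = false`. -/
def fixLit {α : Type} (b : Bool) (x : α) : SigS.Formula α :=
  let p : SigS.Formula α := Term.equal (symS.apply₁ (Term.var x)) (Term.var x)
  if b then p else ∼p

/-- `ψ^=_{≥ n}` for `b = true` and `ψ^≠_{≥ n}` for `b = false`. -/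
noncomputable def psiFixGe (b : Bool) (n : ℕ) : SigS.Sentence :=
  Formula.iExs (Fin n)
    (distinct (fun i => Sum.inr i) ⊓ Formula.iInf fun i : Fin n => fixLit b (Sum.inr i))

/-- `ψ^=_{= n}` for `b = true` and `ψ^≠_{= n}` for `b = false`. -/
noncomputable def psiFixEq (b : Bool) (n : ℕ) : SigS.Sentence :=
  Formula.iExs (Fin n)
    (distinct (fun i => Sum.inr i) ⊓ (Formula.iInf (fun i : Fin n => fixLit b (Sum.inr i)) ⊓
      Formula.iAlls Unit ((fixLit b (Sum.inr ())).imp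
        (Formula.iSup fun i : Fin n => eqVar (Sum.inr ()) (Sum.inl (Sum.inr i))))))

/-- The number of `i ∈ {1, …, k}` with `f i = b`: this is `f₁ k` for `b = true`, and `f₀ k` for
`b = false`. -/
def count (f : ℕ → Bool) (b : Bool) (k : ℕ) : ℕ := ((Finset.Icc 1 k).filter fun i => f i = b).card

/-- The functions `f : {1, 2, …} → {0, 1}` that the theories `T_f` are built from, with `true` for
`1` and `false` for `0`. The value `f 0` plays no role. -/
structure IsAdmissible (f : ℕ → Bool) : Prop where
  one : f 1 = true
  balanced : ∀ k : ℕ, 1 ≤ k → count f true (2 ^ k) = count f false (2 ^ k)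
  not_computable : ¬ Computable f

/-- The axiom of `T_f` with index `k`. -/
noncomputable def axiomF (f : ℕ → Bool) (k : ℕ) : SigS.Sentence :=
  (psiFixGe true (count f true k) ⊓ psiFixGe false (count f false k)) ⊔
    Formula.iSup fun i : Fin k =>
      psiFixEq true (count f true (i + 1)) ⊓ psiFixEq false (count f false (i + 1))

/-- `T_f`. -/
noncomputable def theoryF (f : ℕ → Bool) : SigS.Theory :=
  {σ | ∃ k : ℕ, 1 ≤ k ∧ σ = axiomF f k}

end TheoryCombination

/-!
A `SigS`-structure with infinitely many fixed points of `s` and infinitely many other points is a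
model of `T_f`, and one with `n` elements is a model exactly when `f₁ n` of them are fixed. Padding
any `SigS`-structure with infinitely many points of both kinds preserves the truth of
quantifier-free formulas, so `T_f` has the same satisfiable quantifier-free formulas as the empty
theory, and is decidable whatever `f` is.

In a model of `T_=` at most one `P n` is true, and the truth of a quantifier-free formula depends
only on which `P n` holds and on which variables are equal, so it suffices to try finitely many
assignments. The witness works because distinct fresh variables fill a domain of size `n`. Since
`P n` forces the domain to have `n` elements, `T_=` is not smooth.

In the combination, `P n` excludes the infinite models. For `n ≥ 2`, the formula which says that
`P n` holds and that `m` variables denote distinct fixed points of `s` is satisfiable exactly when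
`m ≤ f₁ n`. Deciding these formulas computes `f₁`, hence `f`.

An admissible `f` is obtained from a noncomputable sequence by inserting after each value its
negation.
-/

namespace TheoryCombination

/-! ### Recursion over Gödel numbers -/

/-- The Gödel number of an implication, as a function of those of its two sides. -/
def impCode (a b : ℕ) : ℕ := 4 * Nat.pair a b + 3

/-- The Gödel number of an equation, as a function of those of its two sides. -/
def equalCode (a b : ℕ) : ℕ := 4 * Nat.pair a b + 1

/-- The pair of numbers from which the Gödel number of an equation, of an atomic formula `R t⃗` or
of an implication is built. -/
def subcodes (c : ℕ) : ℕ × ℕ := (c / 4).unpair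

lemma subcodes_four_mul_pair_add (a b : ℕ) {r : ℕ} (hr : r < 4) :
    subcodes (4 * Nat.pair a b + r) = (a, b) := by
  rw [subcodes, Nat.mul_add_div (by lia), Nat.div_eq_of_lt hr, add_zero, Nat.unpair_pair]

@[simp]
lemma subcodes_impCode (a b : ℕ) : subcodes (impCode a b) = (a, b) :=
  subcodes_four_mul_pair_add a b (by lia)

@[simp]
lemma subcodes_equalCode (a b : ℕ) : subcodes (equalCode a b) = (a, b) :=
  subcodes_four_mul_pair_add a b (by lia)

lemma impCode_mod (a b : ℕ) : impCode a b % 4 = 3 := by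
  rw [impCode]; lia

lemma equalCode_mod (a b : ℕ) : equalCode a b % 4 = 1 := by
  rw [equalCode]; lia

lemma impCode_subcodes {c : ℕ} (hc : c % 4 = 3) :
    impCode (subcodes c).1 (subcodes c).2 = c := by
  rw [impCode, subcodes, Nat.pair_unpair]; lia

lemma subcodes_fst_lt {c : ℕ} (hc : c ≠ 0) : (subcodes c).1 < c :=
  (Nat.unpair_left_le _).trans_lt (by lia)

lemma subcodes_snd_lt {c : ℕ} (hc : c ≠ 0) : (subcodes c).2 < c :=
  (Nat.unpair_right_le _).trans_lt (by lia)

lemma left_lt_impCode (a b : ℕ) : a < impCode a b := by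
  simpa using subcodes_fst_lt (c := impCode a b) (Nat.succ_ne_zero _)

lemma right_lt_impCode (a b : ℕ) : b < impCode a b := by
  simpa using subcodes_snd_lt (c := impCode a b) (Nat.succ_ne_zero _)

/-- The Gödel number of the term `g t` with a unary function symbol `g` of number `0`, as a function
of that of `t`. -/
def appCode (t : ℕ) : ℕ := 3 * Nat.pair (Nat.pair 1 0) (Encodable.encode [t]) + 2

/-- The Gödel number of `t`, as a function of that of the term `g t`. -/
def argCode (t : ℕ) : ℕ := ((t / 3).unpair.2 - 1).unpair.1

lemma appCode_mod (t : ℕ) : appCode t % 3 = 2 := by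
  rw [appCode]; lia

@[simp]
lemma argCode_appCode (t : ℕ) : argCode (appCode t) = t := by
  rw [argCode, appCode, Nat.mul_add_div (by lia)]
  simp [Encodable.encode_list_cons]

lemma argCode_lt {t : ℕ} (ht : t ≠ 0) : argCode t < t :=
  (Nat.unpair_left_le _).trans_lt <|
    (Nat.sub_le _ _).trans_lt ((Nat.unpair_right_le _).trans_lt (by lia))

section Folds

variable {σ : Type*}

/-- Recursion over Gödel numbers of formulas: implications are handled by `node`, everything else
by `leaf`. -/
def codeFold (leaf : ℕ → σ) (node : σ → σ → σ) (c : ℕ) : σ :=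
  if _h : c % 4 = 3 then
    node (codeFold leaf node (subcodes c).1) (codeFold leaf node (subcodes c).2)
  else leaf c
termination_by c
decreasing_by
  · exact subcodes_fst_lt (by lia)
  · exact subcodes_snd_lt (by lia)

lemma codeFold_of_mod_ne (leaf : ℕ → σ) (node : σ → σ → σ) {c : ℕ} (h : c % 4 ≠ 3) :
    codeFold leaf node c = leaf c := by
  rw [codeFold, dif_neg h]

lemma codeFold_impCode (leaf : ℕ → σ) (node : σ → σ → σ) (a b : ℕ) :
    codeFold leaf node (impCode a b) = node (codeFold leaf node a) (codeFold leaf node b) := by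
  rw [codeFold, dif_pos (impCode_mod a b), subcodes_impCode]

/-- Recursion over Gödel numbers of terms with unary function symbols. -/
def termFold (leaf : ℕ → σ) (node : ℕ → σ → σ) (t : ℕ) : σ :=
  if _h : t % 3 = 2 then node t (termFold leaf node (argCode t)) else leaf t
termination_by t
decreasing_by exact argCode_lt (by lia)

lemma termFold_of_mod_ne (leaf : ℕ → σ) (node : ℕ → σ → σ) {t : ℕ} (h : t % 3 ≠ 2) :
    termFold leaf node t = leaf t := by
  rw [termFold, dif_neg h]

lemma termFold_appCode (leaf : ℕ → σ) (node : ℕ → σ → σ) (t : ℕ) :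
    termFold leaf node (appCode t) = node (appCode t) (termFold leaf node t) := by
  rw [termFold, dif_pos (appCode_mod t), argCode_appCode]

end Folds

section PrimrecFolds

variable {α σ : Type*} [Primcodable α] [Primcodable σ]

lemma primrec_subcodes : Primrec subcodes :=
  Primrec.unpair.comp (Primrec.nat_div.comp Primrec.id (Primrec.const 4))

lemma primrec_impCode : Primrec₂ impCode :=
  Primrec.nat_add.comp₂ (Primrec.nat_mul.comp₂ (Primrec₂.const 4) Primrec₂.natPair)
    (Primrec₂.const 3)

lemma primrec_equalCode : Primrec₂ equalCode :=
  Primrec.nat_add.comp₂ (Primrec.nat_mul.comp₂ (Primrec₂.const 4) Primrec₂.natPair)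
    (Primrec₂.const 1)

lemma primrec_appCode : Primrec appCode :=
  Primrec.nat_add.comp (Primrec.nat_mul.comp (Primrec.const 3)
    (Primrec₂.natPair.comp (Primrec.const _)
      (Primrec.encode.comp (Primrec.list_cons.comp Primrec.id (Primrec.const [])))))
    (Primrec.const 2)

lemma primrec_argCode : Primrec argCode :=
  Primrec.fst.comp <| Primrec.unpair.comp <| Primrec.nat_sub.comp (Primrec.snd.comp <|
    Primrec.unpair.comp <| Primrec.nat_div.comp Primrec.id (Primrec.const 3)) (Primrec.const 1)

lemma primrec_codeFold {leaf : α → ℕ → σ} {node : α → σ → σ → σ} {f : α → ℕ}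
    (hleaf : Primrec₂ leaf) (hnode : Primrec fun p : α × σ × σ => node p.1 p.2.1 p.2.2)
    (hf : Primrec f) : Primrec fun a => codeFold (leaf a) (node a) (f a) := by
  refine (Primrec.nat_strong_rec (fun a c => codeFold (leaf a) (node a) c) (g := fun a l =>
    if l.length % 4 = 3 then
      l[(subcodes l.length).1]?.bind fun x => l[(subcodes l.length).2]?.map fun y => node a x y
    else some (leaf a l.length)) ?_ fun a c => ?_).comp Primrec.id hf
  · have hlen : Primrec fun p : α × List σ => p.2.length := Primrec.list_length.comp Primrec.snd
    have hsub := primrec_subcodes.comp hlen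
    refine Primrec.ite (Primrec.eq.comp (Primrec.nat_mod.comp hlen (Primrec.const 4))
      (Primrec.const 3)) ?_ (Primrec.option_some.comp (hleaf.comp Primrec.fst hlen))
    refine Primrec.option_bind
      (Primrec.list_getElem?.comp Primrec.snd (Primrec.fst.comp hsub)) ?_
    refine Primrec.option_map (Primrec.list_getElem?.comp (Primrec.snd.comp Primrec.fst)
      (Primrec.snd.comp (hsub.comp Primrec.fst))) ?_
    exact hnode.comp (Primrec.pair (Primrec.fst.comp (Primrec.fst.comp Primrec.fst))
      (Primrec.pair (Primrec.snd.comp Primrec.fst) Primrec.snd))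
  · rw [List.length_map, List.length_range, codeFold]
    split_ifs with h
    · have hc : c ≠ 0 := by lia
      simp [subcodes_fst_lt hc, subcodes_snd_lt hc]
    · rfl

lemma primrec_termFold {leaf : α → ℕ → σ} {node : α → ℕ → σ → σ} {f : α → ℕ}
    (hleaf : Primrec₂ leaf) (hnode : Primrec fun p : α × ℕ × σ => node p.1 p.2.1 p.2.2)
    (hf : Primrec f) : Primrec fun a => termFold (leaf a) (node a) (f a) := by
  refine (Primrec.nat_strong_rec (fun a t => termFold (leaf a) (node a) t) (g := fun a l =>
    if l.length % 3 = 2 then l[argCode l.length]?.map fun x => node a l.length x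
    else some (leaf a l.length)) ?_ fun a t => ?_).comp Primrec.id hf
  · have hlen : Primrec fun p : α × List σ => p.2.length := Primrec.list_length.comp Primrec.snd
    refine Primrec.ite (Primrec.eq.comp (Primrec.nat_mod.comp hlen (Primrec.const 3))
      (Primrec.const 2)) ?_ (Primrec.option_some.comp (hleaf.comp Primrec.fst hlen))
    refine Primrec.option_map
      (Primrec.list_getElem?.comp Primrec.snd (primrec_argCode.comp hlen)) ?_
    exact hnode.comp (Primrec.pair (Primrec.fst.comp Primrec.fst)
      (Primrec.pair (hlen.comp Primrec.fst) Primrec.snd))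
  · rw [List.length_map, List.length_range, termFold]
    split_ifs with h
    · simp [argCode_lt (t := t) (by lia)]
    · rfl

end PrimrecFolds

/-! ### Tables of bounded functions -/

/-- The lists of length `n` with entries at most `B`. Such a list stores the values below `n` of a
function bounded by `B`, and is read by `List.getD` with default `0`. -/
def tables (B : ℕ) : ℕ → List (List ℕ)
  | 0 => [ [] ]
  | n + 1 => (tables B n).flatMap fun l => (List.range (B + 1)).map fun x => l ++ [x]

lemma map_range_mem_tables {B : ℕ} {h : ℕ → ℕ} (hB : ∀ i, h i ≤ B) (n : ℕ) :
    (List.range n).map h ∈ tables B n := by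
  induction n with
  | zero => exact List.mem_singleton_self _
  | succ n ih =>
    refine List.mem_flatMap.2 ⟨_, ih, List.mem_map.2 ⟨h n, ?_, ?_⟩⟩
    · exact List.mem_range.2 (Nat.lt_succ_of_le (hB n))
    · rw [List.range_succ, List.map_append, List.map_singleton]

lemma exists_mem_tables (B n : ℕ) (h : ℕ → ℕ) :
    ∃ l ∈ tables B n, ∀ i < n, h i ≤ B → l.getD i 0 = h i :=
  ⟨_, map_range_mem_tables (h := fun i => min B (h i)) (fun _ => min_le_left _ _) n,
    fun i hi hB => by simp [hi, hB]⟩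

lemma primrec_tables : Primrec₂ tables := by
  refine (Primrec.nat_rec (f := fun _ : ℕ => [ [] ]) (g := fun B p => p.2.flatMap fun l =>
    (List.range (B + 1)).map fun x => l ++ [x]) (Primrec.const _) ?_).of_eq fun B n => ?_
  · refine Primrec.list_flatMap (Primrec.snd.comp Primrec.snd) ?_
    refine Primrec.list_map (Primrec.list_range.comp <| Primrec.succ.comp <|
      Primrec.fst.comp Primrec.fst) ?_
    exact Primrec.list_concat.comp (Primrec.snd.comp Primrec.fst) Primrec.snd
  · induction n with
    | zero => rfl
    | succ n ih => exact congrArg (List.flatMap _) ih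

/-! ### Decidability by bounded search -/

section Search

variable {L : FirstOrder.Language.{0, 0}} [SymbolCoding L]

lemma formulaCode_bot {n : ℕ} : formulaCode (⊥ : L.BoundedFormula ℕ n) = 0 := by
  rw [Bot.bot, BoundedFormula.instBot, formulaCode]

lemma formulaCode_equal {n : ℕ} (t u : L.Term (ℕ ⊕ Fin n)) :
    formulaCode (BoundedFormula.equal t u) = equalCode (termCode t) (termCode u) := by
  rw [formulaCode, equalCode]

lemma formulaCode_imp {n : ℕ} (φ ψ : L.BoundedFormula ℕ n) :
    formulaCode (φ.imp ψ) = impCode (formulaCode φ) (formulaCode ψ) := by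
  rw [formulaCode, impCode]

lemma formulaCode_mod_of_isAtomic {n : ℕ} {φ : L.BoundedFormula ℕ n} (h : φ.IsAtomic) :
    formulaCode φ % 4 = 1 ∨ formulaCode φ % 4 = 2 := by
  cases h with
  | equal t u => left; rw [Term.bdEqual, formulaCode]; lia
  | rel R ts => right; rw [Relations.boundedFormula, formulaCode]; lia

/-- Tests whether a number is the Gödel number of a quantifier-free formula, given a test `ok` for
the Gödel numbers of `⊥` and of atomic formulas. -/
def isQFCode (ok : ℕ → Bool) : ℕ → Bool := codeFold ok (· && ·)

/-- The truth value of the formula with a given Gödel number, when `leaf` gives the truth values of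
`⊥` and of the atomic formulas. -/
def evalCode (leaf : ℕ → Bool) : ℕ → Bool := codeFold leaf fun x y => !x || y

lemma isQFCode_iff {ok : ℕ → Bool}
    (hok : ∀ c, ok c = true ↔
      c = 0 ∨ ∃ φ : L.Formula ℕ, BoundedFormula.IsAtomic φ ∧ formulaCode φ = c) (c : ℕ) :
    isQFCode ok c = true ↔ ∃ φ : L.Formula ℕ, QF φ ∧ formulaCode φ = c := by
  constructor
  · induction c using Nat.strong_induction_on with
    | _ c ih =>
      intro h
      by_cases hc : c % 4 = 3
      · have hc0 : c ≠ 0 := by lia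
        rw [← impCode_subcodes hc, isQFCode, codeFold_impCode, Bool.and_eq_true] at h
        obtain ⟨φ, hφ, hφc⟩ := ih _ (subcodes_fst_lt hc0) h.1
        obtain ⟨ψ, hψ, hψc⟩ := ih _ (subcodes_snd_lt hc0) h.2
        exact ⟨φ.imp ψ, hφ.imp hψ, by rw [formulaCode_imp, hφc, hψc, impCode_subcodes hc]⟩
      · rw [isQFCode, codeFold_of_mod_ne _ _ hc, hok] at h
        rcases h with rfl | ⟨φ, hφ, rfl⟩
        · exact ⟨⊥, BoundedFormula.isQF_bot, formulaCode_bot⟩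
        · exact ⟨φ, hφ.isQF, rfl⟩
  · rintro ⟨φ, hφ, rfl⟩
    induction hφ with
    | falsum =>
      rw [formulaCode, isQFCode, codeFold_of_mod_ne _ _ (by decide), hok]
      exact Or.inl rfl
    | of_isAtomic h =>
      have hm := formulaCode_mod_of_isAtomic h
      exact (codeFold_of_mod_ne ok _ (by lia)).trans ((hok _).2 (Or.inr ⟨_, h, rfl⟩))
    | imp _ _ hφ hψ =>
      rw [formulaCode_imp, isQFCode, codeFold_impCode, Bool.and_eq_true]
      exact ⟨hφ, hψ⟩

lemma evalCode_iff {M : Type*} [L.Structure M] {v : ℕ → M} {leaf : ℕ → Bool} (h0 : leaf 0 = false)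
    {φ : L.Formula ℕ} (hφ : QF φ)
    (hleaf : ∀ ψ : L.Formula ℕ, BoundedFormula.IsAtomic ψ → formulaCode ψ ≤ formulaCode φ →
      (leaf (formulaCode ψ) = true ↔ ψ.Realize v)) :
    evalCode leaf (formulaCode φ) = true ↔ φ.Realize v := by
  induction hφ with
  | falsum =>
    rw [formulaCode, evalCode, codeFold_of_mod_ne _ _ (by decide), h0]
    exact iff_of_false Bool.false_ne_true id
  | of_isAtomic h =>
    have hm := formulaCode_mod_of_isAtomic h
    rw [evalCode, codeFold_of_mod_ne _ _ (by lia)]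
    exact hleaf _ h le_rfl
  | @imp φ ψ _ _ ihφ ihψ =>
    rw [formulaCode_imp] at hleaf
    specialize ihφ fun χ hχ hle => hleaf χ hχ (hle.trans (left_lt_impCode _ _).le)
    specialize ihψ fun χ hχ hle => hleaf χ hχ (hle.trans (right_lt_impCode _ _).le)
    rw [formulaCode_imp, evalCode, codeFold_impCode, Formula.realize_imp, ← ihφ, ← ihψ,
      Bool.or_eq_true, Bool.not_eq_true', ← Bool.not_eq_true, imp_iff_not_or]
    rfl

theorem decidableTheory_of_search {T : L.Theory} {γ : Type*} [Primcodable γ] {cand : ℕ → List γ}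
    {ok : ℕ → Bool} {leaf : γ → ℕ → Bool} (hok : Primrec ok) (hleaf : Primrec₂ leaf)
    (hcand : Primrec cand)
    (hatom : ∀ c, ok c = true ↔
      c = 0 ∨ ∃ φ : L.Formula ℕ, BoundedFormula.IsAtomic φ ∧ formulaCode φ = c)
    (hsat : ∀ φ : L.Formula ℕ, QF φ → (Satisfiable T φ ↔
      ∃ w ∈ cand (formulaCode φ), evalCode (leaf w) (formulaCode φ) = true)) :
    DecidableTheory T := by
  have hqf : Primrec (isQFCode ok) :=
    primrec_codeFold (α := ℕ) (node := fun _ x y => x && y) (hok.comp₂ Primrec₂.right)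
      (Primrec.and.comp (Primrec.fst.comp Primrec.snd) (Primrec.snd.comp Primrec.snd)) Primrec.id
  have heval : Primrec₂ fun (w : γ) (c : ℕ) => evalCode (leaf w) c :=
    primrec_codeFold (α := γ × ℕ) (leaf := fun p => leaf p.1) (node := fun _ x y => !x || y)
      (hleaf.comp₂ (Primrec.fst.comp₂ Primrec₂.left) Primrec₂.right)
      (Primrec.or.comp (Primrec.not.comp (Primrec.fst.comp Primrec.snd))
        (Primrec.snd.comp Primrec.snd)) Primrec.snd
  have htrue : PrimrecRel fun w c => evalCode (leaf w) c = true :=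
    Primrec.eq.comp heval (Primrec.const true)
  have hsearch : PrimrecPred fun c => ∃ w ∈ cand c, evalCode (leaf w) c = true :=
    htrue.exists_mem_list.comp hcand Primrec.id
  obtain ⟨_, hdec⟩ := (Primrec.eq.comp hqf (Primrec.const true)).and hsearch
  refine ComputablePred.of_eq ⟨_, hdec.to_comp⟩ fun c => ?_
  rw [isQFCode_iff hatom]
  constructor
  · rintro ⟨⟨φ, hφ, rfl⟩, h⟩
    exact ⟨φ, hφ, rfl, (hsat φ hφ).2 h⟩
  · rintro ⟨φ, hφ, rfl, h⟩
    exact ⟨⟨φ, hφ, rfl⟩, (hsat φ hφ).1 h⟩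

end Search

/-! ### Semantics of cardinality formulas -/

section Realize

variable {L : FirstOrder.Language.{0, 0}} {M : Type*} [L.Structure M] {α : Type}

@[simp]
lemma realize_eqVar {v : α → M} {x y : α} : (eqVar x y : L.Formula α).Realize v ↔ v x = v y := by
  simp [eqVar]

@[simp]
lemma realize_bigAnd {v : ℕ → M} {l : List (L.Formula ℕ)} :
    (bigAnd l).Realize v ↔ ∀ φ ∈ l, φ.Realize v :=
  BoundedFormula.realize_foldr_inf l v default

@[simp]
lemma realize_bigOr {v : ℕ → M} {l : List (L.Formula ℕ)} :
    (bigOr l).Realize v ↔ ∃ φ ∈ l, φ.Realize v :=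
  BoundedFormula.realize_foldr_sup l v default

lemma realize_distinct {n : ℕ} {x : Fin n → α} {v : α → M} :
    (distinct x : L.Formula α).Realize v ↔ Function.Injective (v ∘ x) := by
  simp only [distinct, Formula.realize_iInf, Formula.realize_not, realize_eqVar, Subtype.forall,
    Prod.forall]
  exact ⟨fun h => Function.Injective.of_lt_imp_ne fun _ _ hij => h _ _ hij,
    fun h _ _ hij => h.ne hij.ne⟩

lemma realize_psiGe {n : ℕ} : M ⊨ psiGe L n ↔ ∃ x : Fin n → M, Function.Injective x := by
  simp only [psiGe, Sentence.Realize, Formula.realize_iExs, realize_distinct]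
  rfl

lemma realize_psiLe {n : ℕ} : M ⊨ psiLe L n ↔ ∃ x : Fin n → M, Function.Surjective x := by
  simp only [psiLe, Sentence.Realize, Formula.realize_iExs, Formula.realize_iAlls,
    Formula.realize_iSup, realize_eqVar]
  refine exists_congr fun x => ⟨fun h a => ?_, fun h y => ?_⟩
  · obtain ⟨i, hi⟩ := h fun _ => a
    exact ⟨i, hi.symm⟩
  · obtain ⟨i, hi⟩ := h (y ())
    exact ⟨i, hi.symm⟩

lemma realize_psiEq {n : ℕ} : M ⊨ psiEq L n ↔ Nonempty (Fin n ≃ M) := by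
  refine Formula.realize_inf.trans ((and_congr realize_psiGe realize_psiLe).trans ⟨?_, ?_⟩)
  · rintro ⟨⟨x, hx⟩, y, hy⟩
    have : Finite M := Finite.of_surjective y hy
    have hle := Nat.card_le_card_of_injective x hx
    have hge := Nat.card_le_card_of_surjective y hy
    rw [Nat.card_fin] at hle hge
    exact ⟨(Finite.equivFinOfCardEq (hge.antisymm hle)).symm⟩
  · rintro ⟨e⟩
    exact ⟨⟨e, e.injective⟩, e, e.surjective⟩

end Realize

/-! ### Decidability of `T_=` -/

section Atoms

variable {L : FirstOrder.Language.{0, 0}} [SymbolCoding L]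

lemma termCode_var {n : ℕ} (i : ℕ) :
    termCode (Term.var (Sum.inl i) : L.Term (ℕ ⊕ Fin n)) = 3 * i := by
  rw [termCode]

lemma formulaCode_eqVar (x y : ℕ) :
    formulaCode (eqVar x y : L.Formula ℕ) = equalCode (3 * x) (3 * y) :=
  (formulaCode_equal _ _).trans (congrArg₂ equalCode (termCode_var x) (termCode_var y))

/-- The Gödel number of the atomic sentence `P n`. -/
def atomPCode (n : ℕ) : ℕ := 4 * Nat.pair (Nat.pair 0 n) 0 + 2

lemma formulaCode_atomP (n : ℕ+) : formulaCode (atomP n : SigP.Formula ℕ) = atomPCode n := by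
  simp only [atomP, Relations.formula, Relations.boundedFormula, formulaCode, List.ofFn_zero]
  rfl

/-- The number `n` such that `c` is the Gödel number of `P n`. -/
def symIndex (c : ℕ) : ℕ := (subcodes c).1.unpair.2

@[simp]
lemma symIndex_atomPCode (n : ℕ) : symIndex (atomPCode n) = n := by
  rw [symIndex, atomPCode, subcodes_four_mul_pair_add _ _ (by lia), Nat.unpair_pair]

lemma atomPCode_mod (n : ℕ) : atomPCode n % 4 = 2 := by
  rw [atomPCode]; lia

lemma lt_atomPCode (n : ℕ) : n < atomPCode n := by
  have hlt : (subcodes (atomPCode n)).1 < atomPCode n := subcodes_fst_lt (Nat.succ_ne_zero _)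
  exact (symIndex_atomPCode n).ge.trans_lt ((Nat.unpair_right_le _).trans_lt hlt)

lemma sigP_isAtomic_iff {φ : SigP.Formula ℕ} :
    BoundedFormula.IsAtomic φ ↔ (∃ i j, φ = eqVar i j) ∨ ∃ n, φ = atomP n := by
  constructor
  · have eq_var (t : SigP.Term (ℕ ⊕ Fin 0)) : ∃ i, t = Term.var (Sum.inl i) := by
      rcases t with (i | i) | ⟨f, _⟩
      exacts [⟨i, rfl⟩, i.elim0, f.elim]
    rintro (⟨t, u⟩ | ⟨⟨n⟩, ts⟩)
    · obtain ⟨i, rfl⟩ := eq_var t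
      obtain ⟨j, rfl⟩ := eq_var u
      exact Or.inl ⟨i, j, rfl⟩
    · exact Or.inr ⟨n, congrArg (BoundedFormula.rel (symP n)) (Subsingleton.elim _ _)⟩
  · rintro (⟨i, j, rfl⟩ | ⟨n, rfl⟩)
    · exact .equal _ _
    · exact .rel _ _

end Atoms

section ModelsEq

/-- `P n` holds in `M`. -/
def HoldsP (M : Type*) [SigP.Structure M] (n : ℕ+) : Prop :=
  Structure.RelMap (symP n) (default : Fin 0 → M)

@[simp]
lemma realize_atomP {M : Type*} [SigP.Structure M] {α : Type} {v : α → M} {n : ℕ+} :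
    (atomP n : SigP.Formula α).Realize v ↔ HoldsP M n := by
  rw [atomP, Formula.realize_rel, HoldsP]
  exact iff_of_eq (congrArg _ (Subsingleton.elim _ _))

lemma models_theoryEq_iff {M : Type*} [SigP.Structure M] :
    M ⊨ theoryEq ↔ ∀ n : ℕ+, HoldsP M n → Nonempty (Fin n ≃ M) := by
  simp only [theoryEq, Theory.model_iff, Set.forall_mem_range]
  exact forall_congr' fun n =>
    Formula.realize_imp.trans (imp_congr realize_atomP realize_psiEq)

/-- The structure on `M` in which `P n` holds if `Q n`. -/
@[reducible]
def structureP (M : Type*) (Q : ℕ → Prop) : SigP.Structure M where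
  funMap f := f.elim
  RelMap R _ := Q R.index

lemma not_smooth_theoryEq : ¬ Smooth theoryEq := by
  intro h
  let _ : SigP.Structure Unit := structureP _ (· = 1)
  have hUnit : Unit ⊨ theoryEq := models_theoryEq_iff.2 fun n (hn : (n : ℕ) = 1) =>
    ⟨(finCongr hn).trans (Equiv.ofUnique _ _)⟩
  obtain ⟨B, hB, hcard⟩ := h (atomP 1) (BoundedFormula.IsAtomic.isQF (.rel _ _))
    ⟨Unit, fun _ => (), hUnit⟩ (realize_atomP.2 rfl) 2 (by simp)
  obtain ⟨e⟩ := models_theoryEq_iff.1 B.models 1 (realize_atomP.1 hB)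
  have hone := Cardinal.mk_congr e
  simp [hcard] at hone

lemma exists_least_representative {M : Type*} (v : ℕ → M) :
    ∃ r : ℕ → ℕ, (∀ n, r n ≤ n) ∧ (∀ n, v (r n) = v n) ∧ ∀ m n, r m = r n ↔ v m = v n := by
  classical
  have hex (n : ℕ) : ∃ j, v j = v n := ⟨n, rfl⟩
  refine ⟨fun n => Nat.find (hex n), fun n => Nat.find_min' (hex n) rfl,
    fun n => Nat.find_spec (hex n), fun m n => ⟨fun h => ?_, fun h => by simp only [h]⟩⟩
  rw [← Nat.find_spec (hex m), ← Nat.find_spec (hex n)]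
  exact congrArg v h

lemma exists_residues {M : Type*} [SigP.Structure M] (hM : M ⊨ theoryEq) (v : ℕ → M) (N : ℕ) :
    ∃ m ≤ N, ∃ h : ℕ → ℕ, (∀ i ≤ N, h i ≤ N) ∧ (∀ i j, h i % m = h j % m ↔ v i = v j) ∧
      ∀ n : ℕ+, (n : ℕ) ≤ N → (HoldsP M n ↔ (n : ℕ) = m) := by
  rw [models_theoryEq_iff] at hM
  by_cases hP : ∃ n : ℕ+, (n : ℕ) ≤ N ∧ HoldsP M n
  · obtain ⟨n, hn, hPn⟩ := hP
    obtain ⟨e⟩ := hM n hPn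
    refine ⟨n, hn, fun i => e.symm (v i), fun i _ => (e.symm _).is_lt.le.trans hn, fun i j => ?_,
      fun k _ => ⟨fun hPk => ?_, fun hk => PNat.eq hk ▸ hPn⟩⟩
    · rw [Nat.mod_eq_of_lt (e.symm _).is_lt, Nat.mod_eq_of_lt (e.symm _).is_lt, Fin.val_inj,
        e.symm.apply_eq_iff_eq]
    · obtain ⟨e'⟩ := hM k hPk
      exact Fin.equiv_iff_eq.1 ⟨e'.trans e.symm⟩
  · obtain ⟨r, hle, -, hr⟩ := exists_least_representative v
    refine ⟨0, N.zero_le, r, fun i hi => (hle i).trans hi, by simpa only [Nat.mod_zero] using hr,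
      fun n hn => iff_of_false (fun hPn => hP ⟨n, hn, hPn⟩) n.ne_zero⟩

end ModelsEq

section SearchEq

/-- Tests for the Gödel numbers of `⊥` and of the atomic formulas `x = y` and `P n`, by computing
these numbers anew from their parts. -/
def isAtomCodeP (c : ℕ) : Bool :=
  decide (c = 0 ∨ c = equalCode (3 * ((subcodes c).1 / 3)) (3 * ((subcodes c).2 / 3)) ∨
    (symIndex c ≠ 0 ∧ c = atomPCode (symIndex c)))

/-- The value of the variable with index `i` in the `T_=`-interpretation over `ZMod w.1` that is
coded by `w`. -/
def residue (w : ℕ × List ℕ) (i : ℕ) : ℕ := w.2.getD i 0 % w.1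

/-- The truth value of the atomic formula with Gödel number `c` in the interpretation coded by `w`:
the variables denote the residues modulo `w.1` listed in `w.2`, and `P n` holds for `n = w.1` only.
For `w.1 = 0` the domain is infinite and no symbol holds. -/
def evalAtomP (w : ℕ × List ℕ) (c : ℕ) : Bool :=
  decide ((c % 4 = 1 ∧ residue w ((subcodes c).1 / 3) = residue w ((subcodes c).2 / 3)) ∨
    (c % 4 = 2 ∧ symIndex c = w.1))

/-- The codes of interpretations that suffice to satisfy every satisfiable formula with Gödel number
`c`. -/
def candidatesP (c : ℕ) : List (ℕ × List ℕ) :=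
  (List.range (c + 1)).flatMap fun m => (tables c (c + 1)).map fun l => (m, l)

lemma isAtomCodeP_iff (c : ℕ) :
    isAtomCodeP c = true ↔
      c = 0 ∨ ∃ φ : SigP.Formula ℕ, BoundedFormula.IsAtomic φ ∧ formulaCode φ = c := by
  rw [isAtomCodeP, decide_eq_true_iff]
  refine or_congr_right ⟨?_, ?_⟩
  · rintro (h | ⟨hpos, h⟩)
    · exact ⟨eqVar _ _, .equal _ _, (formulaCode_eqVar _ _).trans h.symm⟩
    · exact ⟨atomP ⟨_, Nat.pos_of_ne_zero hpos⟩, .rel _ _, (formulaCode_atomP _).trans h.symm⟩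
  · rintro ⟨φ, hφ, rfl⟩
    rcases sigP_isAtomic_iff.1 hφ with ⟨i, j, rfl⟩ | ⟨n, rfl⟩
    · left
      simp [formulaCode_eqVar]
    · right
      simp [formulaCode_atomP]

lemma evalCode_evalAtomP_iff {M : Type*} [SigP.Structure M] {v : ℕ → M} {w : ℕ × List ℕ}
    {φ : SigP.Formula ℕ} (hφ : QF φ)
    (hv : ∀ i ≤ formulaCode φ, ∀ j ≤ formulaCode φ, residue w i = residue w j ↔ v i = v j)
    (hP : ∀ n : ℕ+, (n : ℕ) ≤ formulaCode φ → (HoldsP M n ↔ (n : ℕ) = w.1)) :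
    evalCode (evalAtomP w) (formulaCode φ) = true ↔ φ.Realize v := by
  refine evalCode_iff (by simp [evalAtomP]) hφ fun ψ hψ hle => ?_
  rcases sigP_isAtomic_iff.1 hψ with ⟨i, j, rfl⟩ | ⟨n, rfl⟩
  · rw [formulaCode_eqVar] at hle ⊢
    have hi : 3 * i < equalCode (3 * i) (3 * j) := by
      simpa using subcodes_fst_lt (c := equalCode (3 * i) (3 * j)) (Nat.succ_ne_zero _)
    have hj : 3 * j < equalCode (3 * i) (3 * j) := by
      simpa using subcodes_snd_lt (c := equalCode (3 * i) (3 * j)) (Nat.succ_ne_zero _)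
    simp [evalAtomP, equalCode_mod, hv i (by lia) j (by lia)]
  · rw [formulaCode_atomP] at hle ⊢
    simp [evalAtomP, atomPCode_mod, hP n ((lt_atomPCode n).le.trans hle)]

lemma satisfiable_theoryEq_of_evalCode {w : ℕ × List ℕ} {φ : SigP.Formula ℕ} (hφ : QF φ)
    (h : evalCode (evalAtomP w) (formulaCode φ) = true) : Satisfiable theoryEq φ := by
  let _ : SigP.Structure (ZMod w.1) := structureP _ (· = w.1)
  have hmod : ZMod w.1 ⊨ theoryEq := models_theoryEq_iff.2 fun n (hn : (n : ℕ) = w.1) => by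
    have : NeZero w.1 := ⟨hn ▸ n.ne_zero⟩
    exact ⟨(Finite.equivFinOfCardEq (by rw [Nat.card_zmod, hn])).symm⟩
  exact ⟨⟨ZMod w.1, fun i => (w.2.getD i 0 : ℕ), hmod⟩, (evalCode_evalAtomP_iff hφ
    (fun i _ j _ => (ZMod.natCast_eq_natCast_iff' _ _ _).symm) fun _ _ => Iff.rfl).1 h⟩

lemma satisfiable_theoryEq_iff {φ : SigP.Formula ℕ} (hφ : QF φ) :
    Satisfiable theoryEq φ ↔
      ∃ w ∈ candidatesP (formulaCode φ), evalCode (evalAtomP w) (formulaCode φ) = true := by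
  refine ⟨fun ⟨A, hA⟩ => ?_, fun ⟨w, _, hw⟩ => satisfiable_theoryEq_of_evalCode hφ hw⟩
  obtain ⟨m, hm, h, hle, hv, hP⟩ := exists_residues A.models A.val (formulaCode φ)
  obtain ⟨l, hl, hget⟩ := exists_mem_tables (formulaCode φ) (formulaCode φ + 1) h
  have hres : ∀ i ≤ formulaCode φ, residue (m, l) i = h i % m := fun i hi => by
    rw [residue, hget i (by lia) (hle i hi)]
  refine ⟨(m, l), List.mem_flatMap.2 ⟨m, List.mem_range.2 (by lia), List.mem_map_of_mem hl⟩,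
    (evalCode_evalAtomP_iff hφ (fun i hi j hj => ?_) hP).2 hA⟩
  rw [hres i hi, hres j hj, hv]

lemma primrec_symIndex : Primrec symIndex :=
  Primrec.snd.comp (Primrec.unpair.comp (Primrec.fst.comp primrec_subcodes))

lemma primrec_atomPCode : Primrec atomPCode :=
  Primrec.nat_add.comp (Primrec.nat_mul.comp (Primrec.const 4)
    (Primrec₂.natPair.comp (Primrec₂.natPair.comp (Primrec.const 0) Primrec.id)
      (Primrec.const 0))) (Primrec.const 2)

lemma primrec_isAtomCodeP : Primrec isAtomCodeP := by
  have hvar {f : ℕ → ℕ} (hf : Primrec f) : Primrec fun c => 3 * (f c / 3) :=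
    Primrec.nat_mul.comp (Primrec.const 3) (Primrec.nat_div.comp hf (Primrec.const 3))
  refine PrimrecPred.decide (.or ?_ (.or ?_ (.and ?_ ?_)))
  · exact Primrec.eq.comp Primrec.id (Primrec.const 0)
  · exact Primrec.eq.comp Primrec.id (primrec_equalCode.comp
      (hvar (Primrec.fst.comp primrec_subcodes)) (hvar (Primrec.snd.comp primrec_subcodes)))
  · exact (Primrec.eq.comp primrec_symIndex (Primrec.const 0)).not
  · exact Primrec.eq.comp Primrec.id (primrec_atomPCode.comp primrec_symIndex)

lemma primrec_residue : Primrec₂ residue :=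
  Primrec.nat_mod.comp ((Primrec.list_getD 0).comp (Primrec.snd.comp Primrec.fst) Primrec.snd)
    (Primrec.fst.comp Primrec.fst)

lemma primrec_evalAtomP : Primrec₂ evalAtomP := by
  have hsub : Primrec fun p : (ℕ × List ℕ) × ℕ => subcodes p.2 := primrec_subcodes.comp Primrec.snd
  have hmod : Primrec fun p : (ℕ × List ℕ) × ℕ => p.2 % 4 :=
    Primrec.nat_mod.comp Primrec.snd (Primrec.const 4)
  have hval {f : (ℕ × List ℕ) × ℕ → ℕ} (hf : Primrec f) :
      Primrec fun p => residue p.1 (f p / 3) :=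
    primrec_residue.comp Primrec.fst (Primrec.nat_div.comp hf (Primrec.const 3))
  refine PrimrecPred.decide (.or (.and (Primrec.eq.comp hmod (Primrec.const 1)) ?_)
    (.and (Primrec.eq.comp hmod (Primrec.const 2)) ?_))
  · exact Primrec.eq.comp (hval (Primrec.fst.comp hsub)) (hval (Primrec.snd.comp hsub))
  · exact Primrec.eq.comp (primrec_symIndex.comp Primrec.snd) (Primrec.fst.comp Primrec.fst)

lemma primrec_candidatesP : Primrec candidatesP := by
  refine Primrec.list_flatMap (Primrec.list_range.comp Primrec.succ) ?_
  refine Primrec.list_map (primrec_tables.comp Primrec.fst (Primrec.succ.comp Primrec.fst)) ?_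
  exact Primrec.pair (Primrec.snd.comp Primrec.fst) Primrec.snd

theorem decidableTheory_theoryEq : DecidableTheory theoryEq :=
  decidableTheory_of_search primrec_isAtomCodeP primrec_evalAtomP primrec_candidatesP
    isAtomCodeP_iff fun _ => satisfiable_theoryEq_iff

end SearchEq

/-! ### Models of `T_f` -/

section ModelsF

/-- The meaning of `s`. -/
def sMap {M : Type*} [SigS.Structure M] (x : M) : M := Structure.funMap symS ![x]

/-- The structure on `M` in which `s` denotes `g`. -/
@[reducible]
def structureS {M : Type*} (g : M → M) : SigS.Structure M where
  funMap {k} f x := match k, f, x with | _, .s, x => g (x 0)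
  RelMap R := R.elim

/-- The set of fixed points of `s` (for `b = true`), respectively its complement. -/
def fixSet (M : Type*) [SigS.Structure M] (b : Bool) : Set M := {x | sMap x = x ↔ b = true}

variable {M : Type*} [SigS.Structure M]

@[simp]
lemma realize_apply_symS {α : Type} {v : α → M} {t : SigS.Term α} :
    (symS.apply₁ t).realize v = sMap (t.realize v) := by
  simp only [Functions.apply₁, Term.realize, sMap, Matrix.vec_single_eq_const]

@[simp]
lemma realize_fixLit {α : Type} {v : α → M} {b : Bool} {x : α} :
    (fixLit b x).Realize v ↔ v x ∈ fixSet M b := by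
  cases b <;> simp [fixLit, fixSet, sMap]

lemma realize_psiFixGe {b : Bool} {n : ℕ} :
    M ⊨ psiFixGe b n ↔ Nonempty (Fin n ↪ fixSet M b) := by
  simp only [psiFixGe, Sentence.Realize, Formula.realize_iExs, Formula.realize_inf,
    realize_distinct, Formula.realize_iInf, realize_fixLit]
  constructor
  · rintro ⟨x, hx, hb⟩
    exact ⟨fun i => ⟨x i, hb i⟩, fun i j hij => hx (congrArg Subtype.val hij)⟩
  · rintro ⟨e⟩
    exact ⟨fun i => e i, Subtype.val_injective.comp e.injective, fun i => (e i).2⟩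

lemma realize_psiFixEq {b : Bool} {n : ℕ} :
    M ⊨ psiFixEq b n ↔ Nonempty (Fin n ≃ fixSet M b) := by
  simp only [psiFixEq, Sentence.Realize, Formula.realize_iExs, Formula.realize_iAlls,
    Formula.realize_inf, Formula.realize_imp, realize_distinct, Formula.realize_iInf,
    Formula.realize_iSup, realize_fixLit, realize_eqVar]
  constructor
  · rintro ⟨x, hx, hb, h⟩
    refine ⟨Equiv.ofBijective (fun i => ⟨x i, hb i⟩)
      ⟨fun i j hij => hx (congrArg Subtype.val hij), fun y => ?_⟩⟩
    obtain ⟨i, hi⟩ := h (fun _ => y) y.2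
    exact ⟨i, Subtype.ext hi.symm⟩
  · rintro ⟨e⟩
    refine ⟨fun i => e i, Subtype.val_injective.comp e.injective, fun i => (e i).2, fun y hy => ?_⟩
    obtain ⟨i, hi⟩ := e.surjective ⟨y (), hy⟩
    exact ⟨i, (congrArg Subtype.val hi).symm⟩

lemma realize_axiomF {f : ℕ → Bool} {k : ℕ} :
    M ⊨ axiomF f k ↔ (∀ b, Nonempty (Fin (count f b k) ↪ fixSet M b)) ∨
      ∃ i < k, ∀ b, Nonempty (Fin (count f b (i + 1)) ≃ fixSet M b) := by
  have realize_inf {σ τ : SigS.Sentence} :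
      Formula.Realize (σ ⊓ τ) (default : Empty → M) ↔ M ⊨ σ ∧ M ⊨ τ := Formula.realize_inf
  rw [axiomF, Sentence.Realize, Formula.realize_sup, Formula.realize_iSup]
  simp only [realize_inf, realize_psiFixGe, realize_psiFixEq, Bool.forall_bool,
    Fin.exists_iff, exists_prop, and_comm]

lemma models_theoryF_iff {f : ℕ → Bool} : M ⊨ theoryF f ↔ ∀ k, 1 ≤ k →
    (∀ b, Nonempty (Fin (count f b k) ↪ fixSet M b)) ∨
      ∃ i < k, ∀ b, Nonempty (Fin (count f b (i + 1)) ≃ fixSet M b) := by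
  simp only [theoryF, Theory.model_iff, ← realize_axiomF]
  exact ⟨fun h k hk => h _ ⟨k, hk, rfl⟩, by rintro h _ ⟨k, hk, rfl⟩; exact h k hk⟩

lemma models_theoryF_of_infinite {f : ℕ → Bool} (h : ∀ b, (fixSet M b).Infinite) :
    M ⊨ theoryF f := by
  refine models_theoryF_iff.2 fun k _ => Or.inl fun b => ?_
  have := (h b).to_subtype
  exact ⟨Fin.valEmbedding.trans (Infinite.natEmbedding _)⟩

end ModelsF

section Padding

/-- The extension of the structure on `M` by infinitely many fixed points and infinitely many other
points. -/
@[reducible]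
def paddedStructure (M : Type*) [SigS.Structure M] : SigS.Structure (M ⊕ ℕ × Bool) :=
  structureS <| Sum.map sMap fun p => (if p.2 then p.1 else p.1 + 1, p.2)

attribute [local instance] paddedStructure

variable {M : Type*} [SigS.Structure M]

lemma fixSet_padded_infinite (b : Bool) : (fixSet (M ⊕ ℕ × Bool) b).Infinite := by
  refine Set.infinite_of_injective_forall_mem (f := fun n : ℕ => Sum.inr (n, b))
    (fun m n h => by simpa using h) fun n => ?_
  change Sum.inr (if b then n else n + 1, b) = Sum.inr (n, b) ↔ b = true
  cases b <;> simp

/-- The inclusion of a structure into its padded extension. -/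
def paddedEmbedding (M : Type*) [SigS.Structure M] : M ↪[SigS] M ⊕ ℕ × Bool where
  toFun := Sum.inl
  inj' := Sum.inl_injective
  map_fun' {_} f x := by
    cases f
    exact congrArg (fun y => Sum.inl (Structure.funMap symS y))
      ((Matrix.vec_single_eq_const _).trans
        (funext fun i => congrArg x (Subsingleton.elim 0 i))).symm
  map_rel' R := R.elim

theorem satisfiable_theoryF_iff_exists_structure {f : ℕ → Bool} {φ : SigS.Formula ℕ} (hφ : QF φ) :
    Satisfiable (theoryF f) φ ↔
      ∃ (M : Type) (_ : SigS.Structure M) (v : ℕ → M), φ.Realize v := by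
  refine ⟨fun ⟨A, hA⟩ => ⟨A.Dom, A.str, A.val, hA⟩, fun ⟨M, _, v, hv⟩ => ?_⟩
  refine ⟨⟨_, paddedEmbedding M ∘ v, models_theoryF_of_infinite fixSet_padded_infinite⟩, ?_⟩
  exact (congrArg (BoundedFormula.Realize φ (paddedEmbedding M ∘ v)) (Subsingleton.elim _ _)).mp
    ((hφ.realize_embedding (paddedEmbedding M)).2 hv)

end Padding

/-! ### Decidability of `T_f` -/

section TermsS

lemma sigS_term_induction {P : SigS.Term (ℕ ⊕ Fin 0) → Prop}
    (var : ∀ i, P (Term.var (Sum.inl i))) (app : ∀ t, P t → P (symS.apply₁ t)) (t) : P t := by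
  induction t with
  | var x =>
    rcases x with i | i
    exacts [var i, i.elim0]
  | func g ts ih =>
    cases g
    have hts : Term.func symS ts = symS.apply₁ (ts 0) := by
      rw [Functions.apply₁, Matrix.vec_single_eq_const]
      exact congrArg _ (funext fun i => congrArg ts (Subsingleton.elim i 0))
    exact hts ▸ app _ (ih 0)

lemma sigS_isAtomic_iff {φ : SigS.Formula ℕ} :
    BoundedFormula.IsAtomic φ ↔ ∃ t u, φ = BoundedFormula.equal t u := by
  constructor
  · rintro (⟨t, u⟩ | ⟨R, _⟩)
    exacts [⟨t, u, rfl⟩, R.elim]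
  · rintro ⟨t, u, rfl⟩
    exact .equal t u

lemma termCode_apply_symS (t : SigS.Term (ℕ ⊕ Fin 0)) :
    termCode (symS.apply₁ t) = appCode (termCode t) := by
  rw [Functions.apply₁, termCode, appCode]
  rfl

/-- The value of the term with Gödel number `t` when `v` gives the values of the variables. -/
def termValue {M : Type*} [SigS.Structure M] (v : ℕ → M) : ℕ → M :=
  termFold (fun t => v (t / 3)) fun _ => sMap

lemma termValue_appCode {M : Type*} [SigS.Structure M] (v : ℕ → M) (t : ℕ) :
    termValue v (appCode t) = sMap (termValue v t) :=
  termFold_appCode _ _ t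

lemma termValue_termCode {M : Type*} [SigS.Structure M] (v : ℕ → M)
    (t : SigS.Term (ℕ ⊕ Fin 0)) : termValue v (termCode t) = t.realize (Sum.elim v default) := by
  induction t using sigS_term_induction with
  | var i =>
    rw [termCode_var, termValue, termFold_of_mod_ne _ _ (by lia),
      Nat.mul_div_cancel_left _ (by lia)]
    rfl
  | app t ih => rw [termCode_apply_symS, termValue_appCode, ih, realize_apply_symS]

end TermsS

section SearchF

/-- Tests for the Gödel numbers of terms. -/
def isTermCodeS : ℕ → Bool :=
  termFold (fun t => t % 3 == 0) fun t b => b && t == appCode (argCode t)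

/-- Tests for the Gödel numbers of `⊥` and of equations. -/
def isAtomCodeS (c : ℕ) : Bool :=
  c == 0 || (isTermCodeS (subcodes c).1 && (isTermCodeS (subcodes c).2 && c % 4 == 1))

/-- The value of the term with Gödel number `t` in the structure on `ℕ` coded by `w`: the values of
the variables are listed in `w.1`, and those of `s` in `w.2`. -/
def evalTermS (w : List ℕ × List ℕ) : ℕ → ℕ :=
  termFold (fun t => w.1.getD (t / 3) 0) fun _ x => w.2.getD x 0

/-- The truth value of the equation with Gödel number `c` in the structure coded by `w`. -/
def evalAtomS (w : List ℕ × List ℕ) (c : ℕ) : Bool :=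
  decide (c % 4 = 1 ∧ evalTermS w (subcodes c).1 = evalTermS w (subcodes c).2)

/-- The codes of structures that suffice to satisfy every satisfiable formula with Gödel number
`c`. -/
def candidatesS (c : ℕ) : List (List ℕ × List ℕ) :=
  (tables c (c + 1)).flatMap fun l => (tables c (c + 1)).map fun l' => (l, l')

lemma isTermCodeS_iff (c : ℕ) :
    isTermCodeS c = true ↔ ∃ t : SigS.Term (ℕ ⊕ Fin 0), termCode t = c := by
  constructor
  · induction c using Nat.strong_induction_on with
    | _ c ih =>
      intro h
      by_cases hc : c % 3 = 2
      · rw [isTermCodeS, termFold, dif_pos hc, Bool.and_eq_true, beq_iff_eq] at h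
        obtain ⟨t, ht⟩ := ih _ (argCode_lt (by lia)) h.1
        exact ⟨symS.apply₁ t, by rw [termCode_apply_symS, ht, ← h.2]⟩
      · rw [isTermCodeS, termFold_of_mod_ne _ _ hc, beq_iff_eq] at h
        exact ⟨Term.var (Sum.inl (c / 3)), (termCode_var _).trans (by lia)⟩
  · rintro ⟨t, rfl⟩
    induction t using sigS_term_induction with
    | var i => rw [termCode_var, isTermCodeS, termFold_of_mod_ne _ _ (by lia)]; simp
    | app t ih =>
      rw [termCode_apply_symS, isTermCodeS, termFold_appCode, ← isTermCodeS, ih]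
      simp

lemma isAtomCodeS_iff (c : ℕ) :
    isAtomCodeS c = true ↔
      c = 0 ∨ ∃ φ : SigS.Formula ℕ, BoundedFormula.IsAtomic φ ∧ formulaCode φ = c := by
  simp only [isAtomCodeS, Bool.or_eq_true, Bool.and_eq_true, beq_iff_eq, isTermCodeS_iff]
  refine or_congr_right ⟨?_, ?_⟩
  · rintro ⟨⟨t, ht⟩, ⟨u, hu⟩, hc⟩
    refine ⟨.equal t u, .equal t u, ?_⟩
    rw [formulaCode_equal, ht, hu, equalCode, subcodes, Nat.pair_unpair]
    lia
  · rintro ⟨φ, hφ, rfl⟩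
    obtain ⟨t, u, rfl⟩ := sigS_isAtomic_iff.1 hφ
    simp [formulaCode_equal, equalCode_mod]

lemma evalCode_evalAtomS_iff {M : Type*} [SigS.Structure M] {v : ℕ → M} {w : List ℕ × List ℕ}
    {φ : SigS.Formula ℕ} (hφ : QF φ)
    (h : ∀ t u : SigS.Term (ℕ ⊕ Fin 0), termCode t ≤ formulaCode φ → termCode u ≤ formulaCode φ →
      (evalTermS w (termCode t) = evalTermS w (termCode u) ↔
        termValue v (termCode t) = termValue v (termCode u))) :
    evalCode (evalAtomS w) (formulaCode φ) = true ↔ φ.Realize v := by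
  refine evalCode_iff (by simp [evalAtomS]) hφ fun ψ hψ hle => ?_
  obtain ⟨t, u, rfl⟩ := sigS_isAtomic_iff.1 hψ
  rw [formulaCode_equal] at hle ⊢
  have hpos : equalCode (termCode t) (termCode u) ≠ 0 := Nat.succ_ne_zero _
  have ht := subcodes_fst_lt hpos
  have hu := subcodes_snd_lt hpos
  rw [subcodes_equalCode] at ht hu
  simp only [evalAtomS, equalCode_mod, subcodes_equalCode, true_and, decide_eq_true_iff,
    h t u (ht.le.trans hle) (hu.le.trans hle), termValue_termCode]
  exact (BoundedFormula.realize_bdEqual t u).symm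

lemma exists_realize_of_evalCode {w : List ℕ × List ℕ} {φ : SigS.Formula ℕ} (hφ : QF φ)
    (h : evalCode (evalAtomS w) (formulaCode φ) = true) :
    ∃ (M : Type) (_ : SigS.Structure M) (v : ℕ → M), φ.Realize v :=
  let _ : SigS.Structure ℕ := structureS fun x => w.2.getD x 0
  ⟨ℕ, _, fun i => w.1.getD i 0, (evalCode_evalAtomS_iff hφ fun _ _ _ _ => Iff.rfl).1 h⟩

/- Every term is represented by the least Gödel number of a term with the same value, and `s` acts
on these representatives. -/
lemma exists_evalTermS_eq_iff {M : Type*} [SigS.Structure M] (v : ℕ → M) (N : ℕ) :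
    ∃ w ∈ candidatesS N, ∀ t u : SigS.Term (ℕ ⊕ Fin 0), termCode t ≤ N → termCode u ≤ N →
      (evalTermS w (termCode t) = evalTermS w (termCode u) ↔
        termValue v (termCode t) = termValue v (termCode u)) := by
  obtain ⟨r, hle, hval, hr⟩ := exists_least_representative (termValue v)
  obtain ⟨l, hl, hvar⟩ := exists_mem_tables N (N + 1) fun i => r (3 * i)
  obtain ⟨l', hl', happ⟩ := exists_mem_tables N (N + 1) fun x => r (appCode x)
  have heval (t : SigS.Term (ℕ ⊕ Fin 0)) :
      termCode t ≤ N → evalTermS (l, l') (termCode t) = r (termCode t) := by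
    induction t using sigS_term_induction with
    | var i =>
      intro hi
      rw [termCode_var] at hi ⊢
      rw [evalTermS, termFold_of_mod_ne _ _ (by lia), Nat.mul_div_cancel_left _ (by lia)]
      exact hvar i (by lia) ((hle _).trans hi)
    | app t ih =>
      intro ht
      rw [termCode_apply_symS] at ht ⊢
      have hlt : termCode t < appCode (termCode t) := by
        simpa using argCode_lt (t := appCode (termCode t)) (Nat.succ_ne_zero _)
      have hrep : r (appCode (r (termCode t))) = r (appCode (termCode t)) := by
        rw [hr, termValue_appCode, termValue_appCode, hval]
      rw [evalTermS, termFold_appCode, ← evalTermS, ih (hlt.le.trans ht), ← hrep]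
      exact happ _ (by have := hle (termCode t); lia) (hrep.trans_le ((hle _).trans ht))
  refine ⟨(l, l'), List.mem_flatMap.2 ⟨l, hl, List.mem_map_of_mem hl'⟩, fun t u ht hu => ?_⟩
  rw [heval t ht, heval u hu, hr]

lemma satisfiable_theoryF_iff {f : ℕ → Bool} {φ : SigS.Formula ℕ} (hφ : QF φ) :
    Satisfiable (theoryF f) φ ↔
      ∃ w ∈ candidatesS (formulaCode φ), evalCode (evalAtomS w) (formulaCode φ) = true := by
  rw [satisfiable_theoryF_iff_exists_structure hφ]
  refine ⟨fun ⟨M, _, v, hv⟩ => ?_, fun ⟨w, _, hw⟩ => exists_realize_of_evalCode hφ hw⟩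
  obtain ⟨w, hw, h⟩ := exists_evalTermS_eq_iff v (formulaCode φ)
  exact ⟨w, hw, (evalCode_evalAtomS_iff hφ h).2 hv⟩

lemma primrec_isTermCodeS : Primrec isTermCodeS := by
  refine primrec_termFold (α := ℕ) (leaf := fun _ t => t % 3 == 0)
    (node := fun _ t b => b && t == appCode (argCode t)) ?_ ?_ Primrec.id
  · exact Primrec.beq.comp (Primrec.nat_mod.comp Primrec.snd (Primrec.const 3)) (Primrec.const 0)
  · have ht : Primrec fun p : ℕ × ℕ × Bool => p.2.1 := Primrec.fst.comp Primrec.snd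
    exact Primrec.and.comp (Primrec.snd.comp Primrec.snd)
      (Primrec.beq.comp ht (primrec_appCode.comp (primrec_argCode.comp ht)))

lemma primrec_isAtomCodeS : Primrec isAtomCodeS :=
  Primrec.or.comp (Primrec.beq.comp Primrec.id (Primrec.const 0)) <|
    Primrec.and.comp (primrec_isTermCodeS.comp (Primrec.fst.comp primrec_subcodes)) <|
      Primrec.and.comp (primrec_isTermCodeS.comp (Primrec.snd.comp primrec_subcodes)) <|
        Primrec.beq.comp (Primrec.nat_mod.comp Primrec.id (Primrec.const 4)) (Primrec.const 1)

lemma primrec_evalTermS : Primrec₂ evalTermS := by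
  refine primrec_termFold (leaf := fun p : (List ℕ × List ℕ) × ℕ => fun t => p.1.1.getD (t / 3) 0)
    (node := fun p _ x => p.1.2.getD x 0) ?_ ?_ Primrec.snd
  · exact (Primrec.list_getD 0).comp (Primrec.fst.comp (Primrec.fst.comp Primrec.fst))
      (Primrec.nat_div.comp Primrec.snd (Primrec.const 3))
  · exact (Primrec.list_getD 0).comp (Primrec.snd.comp (Primrec.fst.comp Primrec.fst))
      (Primrec.snd.comp Primrec.snd)

lemma primrec_evalAtomS : Primrec₂ evalAtomS := by
  have hsub : Primrec fun p : (List ℕ × List ℕ) × ℕ => subcodes p.2 :=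
    primrec_subcodes.comp Primrec.snd
  refine PrimrecPred.decide (.and ?_ ?_)
  · exact Primrec.eq.comp (Primrec.nat_mod.comp Primrec.snd (Primrec.const 4)) (Primrec.const 1)
  · exact Primrec.eq.comp (primrec_evalTermS.comp Primrec.fst (Primrec.fst.comp hsub))
      (primrec_evalTermS.comp Primrec.fst (Primrec.snd.comp hsub))

lemma primrec_candidatesS : Primrec candidatesS := by
  have htables : Primrec fun c => tables c (c + 1) := primrec_tables.comp Primrec.id Primrec.succ
  refine Primrec.list_flatMap htables (Primrec.list_map (htables.comp Primrec.fst) ?_)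
  exact Primrec.pair (Primrec.snd.comp Primrec.fst) Primrec.snd

theorem decidableTheory_theoryF (f : ℕ → Bool) : DecidableTheory (theoryF f) :=
  decidableTheory_of_search primrec_isAtomCodeS primrec_evalAtomS primrec_candidatesS
    isAtomCodeS_iff fun _ => satisfiable_theoryF_iff

end SearchF

/-! ### Variables of formulas and disjunctive normal forms -/

section Vars

variable {L : FirstOrder.Language.{0, 0}}

@[simp]
lemma vars_not (φ : L.Formula ℕ) : vars (∼φ) = vars φ := by
  simp [vars]

@[simp]
lemma vars_inf (φ ψ : L.Formula ℕ) : vars (φ ⊓ ψ) = vars φ ∪ vars ψ := by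
  simp [vars, Min.min]

@[simp]
lemma vars_sup (φ ψ : L.Formula ℕ) : vars (φ ⊔ ψ) = vars φ ∪ vars ψ := by
  simp [vars, Max.max]

@[simp]
lemma vars_eqVar (x y : ℕ) : vars (eqVar x y : L.Formula ℕ) = {x, y} := rfl

@[simp]
lemma vars_top : vars (⊤ : L.Formula ℕ) = ∅ := rfl

lemma mem_vars_bigAnd {l : List (L.Formula ℕ)} {x : ℕ} :
    x ∈ vars (bigAnd l) ↔ ∃ φ ∈ l, x ∈ vars φ := by
  induction l with
  | nil => simp [bigAnd]
  | cons φ l ih => rw [bigAnd, List.foldr_cons, ← bigAnd, vars_inf, Finset.mem_union, ih]; simp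

lemma mem_vars_bigOr {l : List (L.Formula ℕ)} {x : ℕ} :
    x ∈ vars (bigOr l) ↔ ∃ φ ∈ l, x ∈ vars φ := by
  induction l with
  | nil => simp [bigOr, vars, Bot.bot]
  | cons φ l ih => rw [bigOr, List.foldr_cons, ← bigOr, vars_sup, Finset.mem_union, ih]; simp

lemma lt_freshIndex {φ : L.Formula ℕ} {x : ℕ} (hx : x ∈ vars φ) : x < freshIndex φ :=
  Finset.le_sup (f := Nat.succ) hx

lemma realize_congr_of_eqOn_vars {M : Type*} [L.Structure M] {v w : ℕ → M} {φ : L.Formula ℕ}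
    (h : Set.EqOn v w (vars φ)) : φ.Realize v ↔ φ.Realize w := by
  have hv := BoundedFormula.realize_restrictFreeVar (φ := φ) (f := id)
    (v := fun x : vars φ => v x) (v' := v) (xs := default) fun _ => rfl
  have hw := BoundedFormula.realize_restrictFreeVar (φ := φ) (f := id)
    (v := fun x : vars φ => v x) (v' := w) (xs := default) fun x => h x.2
  exact hv.symm.trans hw

lemma qf_bigAnd {l : List (L.Formula ℕ)} (h : ∀ φ ∈ l, QF φ) : QF (bigAnd l) := by
  induction l with
  | nil => exact BoundedFormula.IsQF.top
  | cons φ l ih => exact (h φ (by simp)).inf (ih fun ψ hψ => h ψ (by simp [hψ]))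

lemma qf_bigOr {l : List (L.Formula ℕ)} (h : ∀ φ ∈ l, QF φ) : QF (bigOr l) := by
  induction l with
  | nil => exact BoundedFormula.isQF_bot
  | cons φ l ih => exact (h φ (by simp)).sup (ih fun ψ hψ => h ψ (by simp [hψ]))

lemma qf_eqVar (x y : ℕ) : QF (eqVar x y : L.Formula ℕ) :=
  BoundedFormula.IsAtomic.isQF (.equal _ _)

end Vars

section DNF

variable {L : FirstOrder.Language.{0, 0}}

@[simp]
lemma realize_litToFormula {M : Type*} [L.Structure M] {v : ℕ → M} {l : Lit L} :
    l.toFormula.Realize v ↔ (l.2.Realize v ↔ l.1 = true) := by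
  obtain ⟨b, φ⟩ := l
  cases b <;> simp [Lit.toFormula]

@[simp]
lemma vars_litToFormula (l : Lit L) : vars l.toFormula = vars l.2 := by
  rw [Lit.toFormula]
  split_ifs
  exacts [rfl, vars_not _]

lemma qf_litToFormula {l : Lit L} (hl : BoundedFormula.IsAtomic l.2) : QF l.toFormula := by
  rw [Lit.toFormula]
  split_ifs
  exacts [hl.isQF, hl.isQF.not]

lemma dnf_of_isAtomic {n : ℕ} {φ : L.BoundedFormula ℕ n} (h : φ.IsAtomic) (b : Bool) :
    dnf φ b = [ [(b, φ)] ] := by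
  cases h <;> cases b <;> simp [dnf, Term.bdEqual, Relations.boundedFormula]

lemma exists_mem_dnf_realize_iff {M : Type*} [L.Structure M] {v : ℕ → M} {φ : L.Formula ℕ}
    (hφ : QF φ) (b : Bool) :
    (∃ c ∈ dnf φ b, ∀ l ∈ c, (Lit.toFormula l).Realize v) ↔ (φ.Realize v ↔ b = true) := by
  induction hφ generalizing b with
  | falsum =>
    have hfalsum : ¬ Formula.Realize (BoundedFormula.falsum : L.Formula ℕ) v := id
    cases b <;> simp [dnf, hfalsum]
  | of_isAtomic h => cases b <;> simp [dnf_of_isAtomic h]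
  | imp _ _ ihφ ihψ =>
    rw [Formula.realize_imp]
    cases b with
    | true =>
      simp only [dnf, List.mem_append, or_and_right, exists_or, ihφ, ihψ]
      simp [imp_iff_not_or]
    | false =>
      have hnot := and_congr (ihφ true) (ihψ false)
      simp only [iff_true, Bool.false_eq_true, iff_false] at hnot
      simp only [dnf, List.mem_flatMap, List.mem_map, Bool.false_eq_true, iff_false,
        Classical.not_imp, ← hnot]
      constructor
      · rintro ⟨_, ⟨c, hc, d, hd, rfl⟩, h⟩
        rw [List.forall_mem_append] at h
        exact ⟨⟨c, hc, h.1⟩, d, hd, h.2⟩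
      · rintro ⟨⟨c, hc, h⟩, d, hd, h'⟩
        exact ⟨_, ⟨c, hc, d, hd, rfl⟩, List.forall_mem_append.2 ⟨h, h'⟩⟩

lemma exists_mem_dnf_of_imp {n : ℕ} {φ ψ : L.BoundedFormula ℕ n} {b : Bool}
    {c : List (Bool × L.BoundedFormula ℕ n)} {l : Bool × L.BoundedFormula ℕ n}
    (hc : c ∈ dnf (φ.imp ψ) b) (hl : l ∈ c) :
    (∃ c ∈ dnf φ !b, l ∈ c) ∨ ∃ c ∈ dnf ψ b, l ∈ c := by
  cases b with
  | true => exact (List.mem_append.1 hc).imp (⟨c, ·, hl⟩) (⟨c, ·, hl⟩)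
  | false =>
    simp only [dnf, List.mem_flatMap, List.mem_map] at hc
    obtain ⟨c, hc, d, hd, rfl⟩ := hc
    exact (List.mem_append.1 hl).imp (⟨c, hc, ·⟩) (⟨d, hd, ·⟩)

lemma isAtomic_of_mem_dnf {n : ℕ} {φ : L.BoundedFormula ℕ n} {b : Bool}
    {c : List (Bool × L.BoundedFormula ℕ n)} {l : Bool × L.BoundedFormula ℕ n}
    (hc : c ∈ dnf φ b) (hl : l ∈ c) : l.2.IsAtomic := by
  induction φ generalizing b with
  | falsum => cases b <;> simp_all [dnf]
  | equal t u =>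
    rw [← Term.bdEqual, dnf_of_isAtomic (.equal t u), List.mem_singleton] at hc
    subst hc
    rw [List.mem_singleton.1 hl]
    exact .equal t u
  | rel R ts =>
    rw [← Relations.boundedFormula, dnf_of_isAtomic (.rel R ts), List.mem_singleton] at hc
    subst hc
    rw [List.mem_singleton.1 hl]
    exact .rel R ts
  | imp φ ψ ihφ ihψ =>
    obtain ⟨d, hd, hl⟩ | ⟨d, hd, hl⟩ := exists_mem_dnf_of_imp hc hl
    exacts [ihφ hd hl, ihψ hd hl]
  | all φ => simp [dnf] at hc

lemma freeVarFinset_subset_of_mem_dnf {n : ℕ} {φ : L.BoundedFormula ℕ n} {b : Bool}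
    {c : List (Bool × L.BoundedFormula ℕ n)} {l : Bool × L.BoundedFormula ℕ n}
    (hc : c ∈ dnf φ b) (hl : l ∈ c) : l.2.freeVarFinset ⊆ φ.freeVarFinset := by
  induction φ generalizing b with
  | falsum => cases b <;> simp_all [dnf]
  | equal t u =>
    rw [← Term.bdEqual, dnf_of_isAtomic (.equal t u), List.mem_singleton] at hc
    subst hc
    rw [List.mem_singleton.1 hl]
    rfl
  | rel R ts =>
    rw [← Relations.boundedFormula, dnf_of_isAtomic (.rel R ts), List.mem_singleton] at hc
    subst hc
    rw [List.mem_singleton.1 hl]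
    rfl
  | imp φ ψ ihφ ihψ =>
    obtain ⟨d, hd, hl⟩ | ⟨d, hd, hl⟩ := exists_mem_dnf_of_imp hc hl
    exacts [(ihφ hd hl).trans Finset.subset_union_left,
      (ihψ hd hl).trans Finset.subset_union_right]
  | all φ => simp [dnf] at hc

end DNF

/-! ### Arrangements and distinctness -/

section Arrangement

variable {L : FirstOrder.Language.{0, 0}}

/-- Whether `θ` holds depends only on which of its variables have equal values. -/
def EqualityInvariant (θ : L.Formula ℕ) : Prop :=
  ∀ ⦃M N : Type⦄ [L.Structure M] [L.Structure N] (v : ℕ → M) (w : ℕ → N),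
    (∀ x ∈ vars θ, ∀ y ∈ vars θ, (v x = v y ↔ w x = w y)) → θ.Realize v → θ.Realize w

lemma equalityInvariant_top : EqualityInvariant (⊤ : L.Formula ℕ) :=
  fun _ _ _ _ _ _ _ _ => Formula.realize_top.2 trivial

lemma realize_arrangement {M : Type*} [L.Structure M] {v : ℕ → M} {V : Finset ℕ} {E : Setoid V} :
    (arrangement V E : L.Formula ℕ).Realize v ↔ ∀ x y : V, v x = v y ↔ E x y := by
  classical
  rw [arrangement, realize_bigAnd, List.forall_mem_map]
  simp only [Finset.mem_toList, Finset.mem_univ, forall_const, Prod.forall]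
  refine forall₂_congr fun x y => ?_
  split_ifs with h <;> simp [h]

lemma subset_vars_arrangement {V : Finset ℕ} {E : Setoid V} :
    V ⊆ vars (arrangement V E : L.Formula ℕ) := fun x hx => by
  classical
  refine mem_vars_bigAnd.2 ⟨_, List.mem_map.2 ⟨(⟨x, hx⟩, ⟨x, hx⟩), by simp, rfl⟩, ?_⟩
  split_ifs <;> simp

lemma equalityInvariant_arrangement (V : Finset ℕ) (E : Setoid V) :
    EqualityInvariant (arrangement V E : L.Formula ℕ) := by
  intro M N _ _ v w hvw hv
  rw [realize_arrangement] at hv ⊢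
  intro x y
  rw [← hv x y, hvw x (subset_vars_arrangement x.2) y (subset_vars_arrangement y.2)]

/-- The variables with indices `k, …, k + n - 1` have distinct values. -/
def distinctVars (k n : ℕ) : L.Formula ℕ :=
  bigAnd ((List.range n).flatMap fun j =>
    (List.range j).map fun i => ∼(eqVar (k + i) (k + j)))

lemma realize_distinctVars {M : Type*} [L.Structure M] {v : ℕ → M} {k n : ℕ} :
    (distinctVars k n : L.Formula ℕ).Realize v ↔
      Function.Injective fun i : Fin n => v (k + i) := by
  simp only [distinctVars, realize_bigAnd, List.forall_mem_flatMap, List.forall_mem_map,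
    List.mem_range, Formula.realize_not, realize_eqVar]
  exact ⟨fun h => Function.Injective.of_lt_imp_ne fun i j hij => h j j.2 i hij,
    fun h j hj i hij => h.ne (a₁ := ⟨i, hij.trans hj⟩) (a₂ := ⟨j, hj⟩) (Fin.ne_of_lt hij)⟩

lemma qf_distinctVars (k n : ℕ) : QF (distinctVars k n : L.Formula ℕ) := by
  refine qf_bigAnd ?_
  simp only [List.forall_mem_flatMap, List.forall_mem_map]
  exact fun _ _ _ _ => (qf_eqVar _ _).not

lemma add_mem_vars_distinctVars {k n i : ℕ} (hpos : 0 < i) (hi : i < n) :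
    k + i ∈ vars (distinctVars k n : L.Formula ℕ) :=
  mem_vars_bigAnd.2 ⟨∼(eqVar (k + 0) (k + i)), List.mem_flatMap.2 ⟨i, List.mem_range.2 hi,
    List.mem_map.2 ⟨0, List.mem_range.2 hpos, rfl⟩⟩, by simp⟩

end Arrangement

/-! ### Correctness of the strong witness -/

section Cubes

lemma exists_atomP_of_posIndex_ne_zero {l : Lit SigP} (hl : BoundedFormula.IsAtomic l.2)
    (h : l.posIndex ≠ 0) : ∃ n : ℕ+, l = (true, atomP n) := by
  obtain ⟨b, φ⟩ := l
  obtain ⟨i, j, rfl⟩ | ⟨n, rfl⟩ := sigP_isAtomic_iff.1 hl <;> cases b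
  exacts [absurd rfl h, absurd rfl h, absurd rfl h, ⟨n, rfl⟩]

lemma posIndex_le_maxPosIndex {c : List (Lit SigP)} {l : Lit SigP} (hl : l ∈ c) :
    l.posIndex ≤ maxPosIndex c := by
  induction hl with
  | head => exact le_max_left _ _
  | tail _ _ ih => exact ih.trans (le_max_right _ _)

lemma exists_posIndex_eq_maxPosIndex {c : List (Lit SigP)} (h : maxPosIndex c ≠ 0) :
    ∃ l ∈ c, l.posIndex = maxPosIndex c := by
  induction c with
  | nil => exact absurd rfl h
  | cons a c ih =>
    have hmax : maxPosIndex (a :: c) = max a.posIndex (maxPosIndex c) := rfl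
    rcases le_total (maxPosIndex c) a.posIndex with hle | hle
    · exact ⟨a, List.mem_cons_self, by rw [hmax, max_eq_left hle]⟩
    · rw [hmax, max_eq_right hle] at h ⊢
      exact (ih h).imp fun l hl => hl.imp_left (List.mem_cons_of_mem _)

lemma nonempty_equiv_of_realize_cube {M : Type*} [SigP.Structure M] (hM : M ⊨ theoryEq)
    {v : ℕ → M} {c : List (Lit SigP)} (hc : ∀ l ∈ c, BoundedFormula.IsAtomic l.2)
    (hv : ∀ l ∈ c, (Lit.toFormula l).Realize v) (h : maxPosIndex c ≠ 0) :
    Nonempty (Fin (maxPosIndex c) ≃ M) := by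
  obtain ⟨l, hl, hlc⟩ := exists_posIndex_eq_maxPosIndex h
  obtain ⟨n, rfl⟩ := exists_atomP_of_posIndex_ne_zero (hc l hl) (hlc ▸ h)
  exact hlc ▸ models_theoryEq_iff.1 hM n (realize_atomP.1 (hv _ hl))

lemma realize_cubeWit {M : Type*} [SigP.Structure M] {v : ℕ → M} {k : ℕ}
    {c : List (Lit SigP)} :
    (cubeWit k c).Realize v ↔ (∀ l ∈ c, (Lit.toFormula l).Realize v) ∧
      Function.Injective fun i : Fin (maxPosIndex c) => v (k + i) := by
  rw [cubeWit, ← distinctVars, Formula.realize_inf, Formula.realize_inf, realize_bigAnd,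
    List.forall_mem_map, realize_distinctVars, realize_eqVar, and_iff_right rfl]

lemma self_mem_vars_cubeWit (k : ℕ) (c : List (Lit SigP)) : k ∈ vars (cubeWit k c) := by
  simp [cubeWit]

lemma add_mem_vars_cubeWit {k i : ℕ} {c : List (Lit SigP)} (hi : i < maxPosIndex c) :
    k + i ∈ vars (cubeWit k c) := by
  rcases Nat.eq_zero_or_pos i with rfl | hpos
  · exact self_mem_vars_cubeWit k c
  · rw [cubeWit, ← distinctVars, vars_inf, vars_inf]
    exact Finset.mem_union_right _ (Finset.mem_union_right _ (add_mem_vars_distinctVars hpos hi))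

lemma vars_subset_vars_cubeWit {k : ℕ} {c : List (Lit SigP)} {l : Lit SigP} (hl : l ∈ c) :
    vars l.2 ⊆ vars (cubeWit k c) := fun x hx => by
  rw [cubeWit, vars_inf]
  exact Finset.mem_union_left _
    (mem_vars_bigAnd.2 ⟨_, List.mem_map_of_mem hl, (vars_litToFormula l).symm ▸ hx⟩)

lemma qf_cubeWit {k : ℕ} {c : List (Lit SigP)} (hc : ∀ l ∈ c, BoundedFormula.IsAtomic l.2) :
    QF (cubeWit k c) :=
  (qf_bigAnd (List.forall_mem_map.2 fun l hl => qf_litToFormula (hc l hl))).inf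
    ((qf_eqVar _ _).inf (qf_distinctVars _ _))

end Cubes

section Witness

lemma realize_witEq {M : Type*} [SigP.Structure M] {v : ℕ → M} {φ : SigP.Formula ℕ} :
    (witEq φ).Realize v ↔ ∃ c ∈ dnf φ true, (cubeWit (freshIndex φ) c).Realize v := by
  simp [witEq]

lemma vars_cubeWit_subset_vars_witEq {φ : SigP.Formula ℕ} {c : List (Lit SigP)}
    (hc : c ∈ dnf φ true) : vars (cubeWit (freshIndex φ) c) ⊆ vars (witEq φ) := fun _ hx =>
  mem_vars_bigOr.2 ⟨_, List.mem_map_of_mem hc, hx⟩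

lemma qf_witEq (φ : SigP.Formula ℕ) : QF (witEq φ) :=
  qf_bigOr (List.forall_mem_map.2 fun _ hc => qf_cubeWit fun _ hl => isAtomic_of_mem_dnf hc hl)

lemma exists_realize_witEq {M : Type*} [SigP.Structure M] (hM : M ⊨ theoryEq) {v : ℕ → M}
    {φ : SigP.Formula ℕ} (hφ : QF φ) (hv : φ.Realize v) :
    ∃ w : ℕ → M, (∀ x, x ∉ vars (witEq φ) \ vars φ → w x = v x) ∧ (witEq φ).Realize w := by
  obtain ⟨c, hc, hcube⟩ := (exists_mem_dnf_realize_iff hφ true).2 (iff_of_true hv rfl)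
  have hvars (l) (hl : l ∈ c) : vars l.2 ⊆ vars φ := freeVarFinset_subset_of_mem_dnf hc hl
  obtain ⟨e⟩ : Nonempty (Fin (maxPosIndex c) ↪ M) := by
    by_cases h : maxPosIndex c = 0
    · exact h ▸ ⟨⟨Fin.elim0, fun i => i.elim0⟩⟩
    · exact (nonempty_equiv_of_realize_cube hM (fun l hl => isAtomic_of_mem_dnf hc hl) hcube h).map
        Equiv.toEmbedding
  let fresh (i : Fin (maxPosIndex c)) : ℕ := freshIndex φ + i
  have hfresh : Function.Injective fresh := fun i j h => Fin.ext (Nat.add_left_cancel h)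
  have hnotMem (i) : fresh i ∉ vars φ := fun hi =>
    (lt_freshIndex hi).not_ge (Nat.le_add_right _ _)
  have hold (x) (hx : x ∉ Set.range fresh) : Function.extend fresh e v x = v x :=
    Function.extend_apply' _ _ _ hx
  refine ⟨Function.extend fresh e v, fun x hx => hold x ?_,
    realize_witEq.2 ⟨c, hc, realize_cubeWit.2 ⟨fun l hl => ?_, ?_⟩⟩⟩
  · rintro ⟨i, rfl⟩
    exact hx (Finset.mem_sdiff.2
      ⟨vars_cubeWit_subset_vars_witEq hc (add_mem_vars_cubeWit i.2), hnotMem i⟩)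
  · refine (realize_congr_of_eqOn_vars fun x hx => hold x ?_).2 (hcube l hl)
    rintro ⟨i, rfl⟩
    exact hnotMem i (hvars l hl (vars_litToFormula l ▸ hx))
  · have hext : Function.extend fresh e v ∘ fresh = e :=
      funext fun i => hfresh.extend_apply _ _ i
    change Function.Injective (Function.extend fresh e v ∘ fresh)
    exact hext.symm ▸ e.injective

lemma realize_of_realize_witEq {M : Type*} [SigP.Structure M] {v : ℕ → M} {φ : SigP.Formula ℕ}
    (hφ : QF φ) (h : (witEq φ).Realize v) : φ.Realize v := by
  obtain ⟨c, hc, h⟩ := realize_witEq.1 h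
  exact ((exists_mem_dnf_realize_iff hφ true).1 ⟨c, hc, (realize_cubeWit.1 h).1⟩).2 rfl

lemma exists_interp_on_image {M : Type} (v : ℕ → M) {S : Finset ℕ} (hS : S.Nonempty) :
    ∃ B : Interp theoryEq, (∀ n, ¬ HoldsP B.Dom n) ∧
      (∀ x ∈ S, ∀ y ∈ S, (v x = v y ↔ B.val x = B.val y)) ∧ ∀ b, ∃ x ∈ S, B.val x = b := by
  classical
  obtain ⟨x₀, hx₀⟩ := hS
  let retract (x : ℕ) : ℕ := if x ∈ S then x else x₀
  have hmem (x) : retract x ∈ S := by by_cases hx : x ∈ S <;> simp [retract, hx, hx₀]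
  have hfix (x) (hx : x ∈ S) : retract x = x := if_pos hx
  let _ : SigP.Structure (Set.range (v ∘ retract)) := structureP _ fun _ => False
  refine ⟨⟨_, Set.rangeFactorization (v ∘ retract), models_theoryEq_iff.2 fun n hn =>
    (hn : False).elim⟩, fun n hn => hn, fun x hx y hy => ?_, ?_⟩
  · simp [Set.rangeFactorization, hfix, hx, hy]
  · rintro ⟨_, x, rfl⟩
    exact ⟨retract x, hmem x, Subtype.ext (congrArg v (hfix _ (hmem x)))⟩

lemma realize_litToFormula_of_posIndex_eq_zero {M N : Type*} [SigP.Structure M]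
    [SigP.Structure N] {v : ℕ → M} {w : ℕ → N} {l : Lit SigP}
    (hl : BoundedFormula.IsAtomic l.2) (hpos : l.posIndex = 0) (hN : ∀ n, ¬ HoldsP N n)
    (hvw : ∀ x ∈ vars l.2, ∀ y ∈ vars l.2, (v x = v y ↔ w x = w y))
    (hv : l.toFormula.Realize v) : l.toFormula.Realize w := by
  obtain ⟨b, φ⟩ := l
  obtain ⟨i, j, rfl⟩ | ⟨n, rfl⟩ := sigP_isAtomic_iff.1 hl
  · rw [realize_litToFormula, realize_eqVar] at hv ⊢
    rwa [← hvw i (by simp) j (by simp)]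
  · cases b with
    | true => exact absurd hpos n.ne_zero
    | false => simpa using hN n

/- If the cube forces `P n`, its fresh variables exhaust the domain already. Otherwise one may
pass to the set of values of the variables, with all `P n` false. -/
lemma exists_minimal_witEq_inf {φ θ : SigP.Formula ℕ} (hθ : EqualityInvariant θ)
    (h : Satisfiable theoryEq (witEq φ ⊓ θ)) :
    ∃ A : Interp theoryEq, A.Sat (witEq φ ⊓ θ) ∧ A.Minimal (witEq φ ⊓ θ) := by
  obtain ⟨A, hA⟩ := h
  obtain ⟨hwit, hAθ⟩ := Formula.realize_inf.1 hA
  obtain ⟨c, hc, hcw⟩ := realize_witEq.1 hwit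
  obtain ⟨hcube, hinj⟩ := realize_cubeWit.1 hcw
  have hatomic (l) (hl : l ∈ c) := isAtomic_of_mem_dnf hc hl
  have hsub : vars (cubeWit (freshIndex φ) c) ⊆ vars (witEq φ ⊓ θ) :=
    (vars_cubeWit_subset_vars_witEq hc).trans (vars_inf _ θ ▸ Finset.subset_union_left)
  by_cases hzero : maxPosIndex c = 0
  · obtain ⟨B, hP, hval, hmin⟩ :=
      exists_interp_on_image A.val ⟨_, hsub (self_mem_vars_cubeWit _ c)⟩
    refine ⟨B, Formula.realize_inf.2 ⟨realize_witEq.2 ⟨c, hc, realize_cubeWit.2 ⟨fun l hl => ?_,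
      fun i => (Fin.cast hzero i).elim0⟩⟩, hθ A.val B.val (fun x hx y hy => ?_) hAθ⟩, hmin⟩
    · have hsub' := (vars_subset_vars_cubeWit hl).trans hsub
      exact realize_litToFormula_of_posIndex_eq_zero (hatomic l hl)
        (Nat.eq_zero_of_le_zero ((posIndex_le_maxPosIndex hl).trans_eq hzero)) hP
        (fun x hx y hy => hval x (hsub' hx) y (hsub' hy)) (hcube l hl)
    · exact hval x (by simp [hx]) y (by simp [hy])
  · obtain ⟨e⟩ := nonempty_equiv_of_realize_cube A.models hatomic hcube hzero
    refine ⟨A, hA, fun a => ?_⟩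
    obtain ⟨i, hi⟩ := hinj.surjective_of_finite e a
    exact ⟨freshIndex φ + i, hsub (add_mem_vars_cubeWit i.2), hi⟩

theorem isStrongWitness_witEq : IsStrongWitness theoryEq witEq where
  qf φ _ := qf_witEq φ
  equiv φ hφ A := by
    refine ⟨exists_realize_witEq A.models hφ, fun ⟨v, hv, hwit⟩ => ?_⟩
    refine (realize_congr_of_eqOn_vars fun x hx => hv x fun h => ?_).1
      (realize_of_realize_witEq hφ hwit)
    exact (Finset.mem_sdiff.1 h).2 hx
  minimal φ _ h := by
    have hsat (A : Interp theoryEq) : A.Sat (witEq φ ⊓ ⊤) ↔ A.Sat (witEq φ) := by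
      simp [Interp.Sat]
    obtain ⟨A, hA, hmin⟩ :=
      exists_minimal_witEq_inf equalityInvariant_top (h.imp fun A => (hsat A).2)
    exact ⟨A, (hsat A).1 hA, by simpa [Interp.Minimal] using hmin⟩
  strong _ _ V E h := exists_minimal_witEq_inf (equalityInvariant_arrangement V E) h

end Witness

/-! ### Computability of the strong witness -/

section Codes

variable {L : FirstOrder.Language.{0, 0}} [SymbolCoding L]

/-- The Gödel number of a negation, as a function of that of the negated formula. -/
def notCode (a : ℕ) : ℕ := impCode a 0

/-- The Gödel number of a conjunction, as a function of those of its two sides. -/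
def andCode (a b : ℕ) : ℕ := notCode (impCode a (notCode b))

/-- The Gödel number of a disjunction, as a function of those of its two sides. -/
def orCode (a b : ℕ) : ℕ := impCode (notCode a) b

/-- The Gödel number of `bigAnd`, as a function of those of the conjuncts. -/
def bigAndCode (l : List ℕ) : ℕ := l.foldr andCode (notCode 0)

/-- The Gödel number of `bigOr`, as a function of those of the disjuncts. -/
def bigOrCode (l : List ℕ) : ℕ := l.foldr orCode 0

/-- The Gödel number of `distinctVars k n`. -/
def distinctVarsCode (k n : ℕ) : ℕ :=
  bigAndCode ((List.range n).flatMap fun j =>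
    (List.range j).map fun i => notCode (equalCode (3 * (k + i)) (3 * (k + j))))

lemma formulaCode_not (φ : L.Formula ℕ) : formulaCode (∼φ) = notCode (formulaCode φ) :=
  (formulaCode_imp φ ⊥).trans (by rw [formulaCode_bot, notCode])

lemma formulaCode_inf (φ ψ : L.Formula ℕ) :
    formulaCode (φ ⊓ ψ) = andCode (formulaCode φ) (formulaCode ψ) := by
  change formulaCode (∼(φ.imp (∼ψ))) = _
  rw [formulaCode_not, andCode, ← formulaCode_not ψ]
  exact congrArg notCode (formulaCode_imp φ (∼ψ))

lemma formulaCode_sup (φ ψ : L.Formula ℕ) :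
    formulaCode (φ ⊔ ψ) = orCode (formulaCode φ) (formulaCode ψ) := by
  rw [orCode, ← formulaCode_not]
  exact formulaCode_imp (∼φ) ψ

lemma formulaCode_bigAnd (l : List (L.Formula ℕ)) :
    formulaCode (bigAnd l) = bigAndCode (l.map formulaCode) := by
  induction l with
  | nil => exact (formulaCode_not ⊥).trans (congrArg notCode formulaCode_bot)
  | cons φ l ih =>
    rw [bigAnd, List.foldr_cons, ← bigAnd, formulaCode_inf, ih]
    rfl

lemma formulaCode_bigOr (l : List (L.Formula ℕ)) :
    formulaCode (bigOr l) = bigOrCode (l.map formulaCode) := by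
  induction l with
  | nil => exact formulaCode_bot
  | cons φ l ih =>
    rw [bigOr, List.foldr_cons, ← bigOr, formulaCode_sup, ih]
    rfl

lemma formulaCode_distinctVars (k n : ℕ) :
    formulaCode (distinctVars k n : L.Formula ℕ) = distinctVarsCode k n := by
  simp [distinctVars, distinctVarsCode, formulaCode_bigAnd, List.map_flatMap, Function.comp_def,
    formulaCode_not, formulaCode_eqVar]

lemma primrec_notCode : Primrec notCode :=
  primrec_impCode.comp Primrec.id (Primrec.const 0)

lemma primrec_andCode : Primrec₂ andCode :=
  primrec_notCode.comp₂ (primrec_impCode.comp₂ Primrec₂.left (primrec_notCode.comp₂ Primrec₂.right))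

lemma primrec_orCode : Primrec₂ orCode :=
  primrec_impCode.comp₂ (primrec_notCode.comp₂ Primrec₂.left) Primrec₂.right

lemma primrec_bigAndCode : Primrec bigAndCode :=
  Primrec.list_foldr Primrec.id (Primrec.const _) (primrec_andCode.comp₂
    (Primrec.fst.comp₂ Primrec₂.right) (Primrec.snd.comp₂ Primrec₂.right))

lemma primrec_bigOrCode : Primrec bigOrCode :=
  Primrec.list_foldr Primrec.id (Primrec.const _) (primrec_orCode.comp₂
    (Primrec.fst.comp₂ Primrec₂.right) (Primrec.snd.comp₂ Primrec₂.right))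

lemma primrec_distinctVarsCode : Primrec₂ distinctVarsCode := by
  refine primrec_bigAndCode.comp (Primrec.list_flatMap (Primrec.list_range.comp Primrec.snd)
    (Primrec.list_map (Primrec.list_range.comp Primrec.snd) ?_))
  have hk : Primrec fun a : ((ℕ × ℕ) × ℕ) × ℕ => a.1.1.1 :=
    Primrec.fst.comp (Primrec.fst.comp Primrec.fst)
  have hvar {g : ((ℕ × ℕ) × ℕ) × ℕ → ℕ} (hg : Primrec g) :
      Primrec fun a => 3 * (a.1.1.1 + g a) :=
    Primrec.nat_mul.comp (Primrec.const 3) (Primrec.nat_add.comp hk hg)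
  exact primrec_notCode.comp
    (primrec_equalCode.comp (hvar Primrec.snd) (hvar (Primrec.snd.comp Primrec.fst)))

end Codes

section Dnf

/-- The disjunctive normal forms `dnf φ true` and `dnf φ false` in terms of Gödel numbers. -/
def dnfCode : ℕ → List (List ℕ) × List (List ℕ) :=
  codeFold (fun c => if c = 0 then ([], [ [] ]) else ([ [c] ], [ [notCode c] ]))
    fun x y => (x.2 ++ y.1, x.1.flatMap fun c => y.2.map fun d => c ++ d)

lemma dnfCode_formulaCode {L : FirstOrder.Language.{0, 0}} [SymbolCoding L] {φ : L.Formula ℕ}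
    (hφ : QF φ) : dnfCode (formulaCode φ) =
      ((dnf φ true).map (List.map (formulaCode ∘ Lit.toFormula)),
        (dnf φ false).map (List.map (formulaCode ∘ Lit.toFormula))) := by
  induction hφ with
  | falsum =>
    rw [formulaCode, dnfCode, codeFold_of_mod_ne _ _ (by decide)]
    simp [dnf]
  | of_isAtomic h =>
    have hmod := formulaCode_mod_of_isAtomic h
    rw [dnfCode, codeFold_of_mod_ne _ _ (by lia), if_neg (by lia), dnf_of_isAtomic h,
      dnf_of_isAtomic h]
    simp [Lit.toFormula, formulaCode_not]
  | imp _ _ hφ hψ =>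
    rw [formulaCode_imp, dnfCode, codeFold_impCode, ← dnfCode, hφ, hψ]
    simp [dnf, List.flatMap_map, List.map_flatMap, Function.comp_def]

lemma primrec_dnfCode : Primrec dnfCode := by
  have hsingle {α β : Type} [Primcodable α] [Primcodable β] {f : α → β} (hf : Primrec f) :
      Primrec fun a => [f a] := Primrec.list_cons.comp hf (Primrec.const [])
  refine primrec_codeFold (leaf := fun _ c => if c = 0 then ([], [ [] ]) else
      ([ [c] ], [ [notCode c] ])) (node := fun _ x y => (x.2 ++ y.1, x.1.flatMap fun c =>
      y.2.map fun d => c ++ d)) ?_ (Primrec.pair ?_ ?_) Primrec.id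
  · exact Primrec.ite (Primrec.eq.comp Primrec.snd (Primrec.const 0)) (Primrec.const _)
      (Primrec.pair (hsingle (hsingle Primrec.snd))
        (hsingle (hsingle (primrec_notCode.comp Primrec.snd))))
  · exact Primrec.list_append.comp (Primrec.snd.comp (Primrec.fst.comp Primrec.snd))
      (Primrec.fst.comp (Primrec.snd.comp Primrec.snd))
  · exact Primrec.list_flatMap (Primrec.fst.comp (Primrec.fst.comp Primrec.snd))
      (Primrec.list_map (Primrec.snd.comp (Primrec.snd.comp (Primrec.snd.comp Primrec.fst)))
        (Primrec.list_append.comp (Primrec.snd.comp Primrec.fst) Primrec.snd))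

end Dnf

section WitnessCodes

/-- `freshIndex` in terms of Gödel numbers. -/
def freshIndexCode : ℕ → ℕ :=
  codeFold (fun c => if c % 4 = 1 then
    max ((subcodes c).1 / 3 + 1) ((subcodes c).2 / 3 + 1) else 0) max

/-- `Lit.posIndex` in terms of Gödel numbers. -/
def posIndexCode (c : ℕ) : ℕ := if c % 4 = 2 then symIndex c else 0

/-- `maxPosIndex` in terms of Gödel numbers. -/
def maxPosIndexCode (c : List ℕ) : ℕ := (c.map posIndexCode).foldr max 0

/-- `cubeWit` in terms of Gödel numbers. -/
def cubeWitCode (k : ℕ) (c : List ℕ) : ℕ :=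
  andCode (bigAndCode c)
    (andCode (equalCode (3 * k) (3 * k)) (distinctVarsCode k (maxPosIndexCode c)))

lemma freshIndexCode_formulaCode {φ : SigP.Formula ℕ} (hφ : QF φ) :
    freshIndexCode (formulaCode φ) = freshIndex φ := by
  induction hφ with
  | falsum =>
    rw [formulaCode, freshIndexCode, codeFold_of_mod_ne _ _ (by decide)]
    rfl
  | of_isAtomic h =>
    have hmod := formulaCode_mod_of_isAtomic h
    rw [freshIndexCode, codeFold_of_mod_ne _ _ (by lia)]
    obtain ⟨i, j, rfl⟩ | ⟨n, rfl⟩ := sigP_isAtomic_iff.1 h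
    · simp [formulaCode_eqVar, equalCode_mod, freshIndex]
    · rw [formulaCode_atomP, atomPCode_mod]
      rfl
  | imp _ _ hφ hψ =>
    rw [formulaCode_imp, freshIndexCode, codeFold_impCode, ← freshIndexCode, hφ, hψ]
    exact Finset.sup_union.symm

lemma posIndexCode_formulaCode {l : Lit SigP} (hl : BoundedFormula.IsAtomic l.2) :
    posIndexCode (formulaCode (Lit.toFormula l)) = Lit.posIndex l := by
  obtain ⟨_ | _, φ⟩ := l
  · simp [Lit.toFormula, formulaCode_not, notCode, posIndexCode, impCode_mod, Lit.posIndex]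
  · rw [Lit.toFormula, if_pos rfl]
    obtain ⟨i, j, rfl⟩ | ⟨n, rfl⟩ := sigP_isAtomic_iff.1 hl
    · rw [formulaCode_eqVar, posIndexCode, equalCode_mod]
      rfl
    · rw [formulaCode_atomP, posIndexCode, atomPCode_mod, symIndex_atomPCode]
      rfl

lemma maxPosIndexCode_map_formulaCode {c : List (Lit SigP)}
    (hc : ∀ l ∈ c, BoundedFormula.IsAtomic l.2) :
    maxPosIndexCode (c.map (formulaCode ∘ Lit.toFormula)) = maxPosIndex c := by
  rw [maxPosIndexCode, maxPosIndex, List.map_map]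
  exact congrArg _ (List.map_congr_left fun l hl => posIndexCode_formulaCode (hc l hl))

lemma cubeWitCode_map_formulaCode {k : ℕ} {c : List (Lit SigP)}
    (hc : ∀ l ∈ c, BoundedFormula.IsAtomic l.2) :
    cubeWitCode k (c.map (formulaCode ∘ Lit.toFormula)) = formulaCode (cubeWit k c) := by
  rw [cubeWitCode, maxPosIndexCode_map_formulaCode hc, cubeWit, ← distinctVars, formulaCode_inf,
    formulaCode_inf, formulaCode_bigAnd, formulaCode_distinctVars, formulaCode_eqVar, List.map_map]

lemma primrec_freshIndexCode : Primrec freshIndexCode := by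
  have hsub : Primrec fun a : ℕ × ℕ => subcodes a.2 := primrec_subcodes.comp Primrec.snd
  refine primrec_codeFold (leaf := fun _ c => if c % 4 = 1 then
      max ((subcodes c).1 / 3 + 1) ((subcodes c).2 / 3 + 1) else 0) (node := fun _ => max) ?_
    (Primrec.nat_max.comp (Primrec.fst.comp Primrec.snd) (Primrec.snd.comp Primrec.snd)) Primrec.id
  exact Primrec.ite
    (Primrec.eq.comp (Primrec.nat_mod.comp Primrec.snd (Primrec.const 4)) (Primrec.const 1))
    (Primrec.nat_max.comp
      (Primrec.succ.comp (Primrec.nat_div.comp (Primrec.fst.comp hsub) (Primrec.const 3)))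
      (Primrec.succ.comp (Primrec.nat_div.comp (Primrec.snd.comp hsub) (Primrec.const 3))))
    (Primrec.const 0)

lemma primrec_maxPosIndexCode : Primrec maxPosIndexCode := by
  have hpos : Primrec posIndexCode := Primrec.ite
    (Primrec.eq.comp (Primrec.nat_mod.comp Primrec.id (Primrec.const 4)) (Primrec.const 2))
    primrec_symIndex (Primrec.const 0)
  exact Primrec.list_foldr (Primrec.list_map Primrec.id (hpos.comp₂ Primrec₂.right))
    (Primrec.const 0)
    (Primrec.nat_max.comp₂ (Primrec.fst.comp₂ Primrec₂.right) (Primrec.snd.comp₂ Primrec₂.right))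

lemma primrec_cubeWitCode : Primrec₂ cubeWitCode := by
  have hvar : Primrec fun a : ℕ × List ℕ => 3 * a.1 :=
    Primrec.nat_mul.comp (Primrec.const 3) Primrec.fst
  exact primrec_andCode.comp (primrec_bigAndCode.comp Primrec.snd)
    (primrec_andCode.comp (primrec_equalCode.comp hvar hvar)
      (primrec_distinctVarsCode.comp Primrec.fst (primrec_maxPosIndexCode.comp Primrec.snd)))

theorem computableOnQF_witEq : ComputableOnQF witEq := by
  refine ⟨fun c => bigOrCode ((dnfCode c).1.map (cubeWitCode (freshIndexCode c))),
    (primrec_bigOrCode.comp (Primrec.list_map (Primrec.fst.comp primrec_dnfCode) ?_)).to_comp,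
    fun φ hφ => ?_⟩
  · exact primrec_cubeWitCode.comp (primrec_freshIndexCode.comp Primrec.fst) Primrec.snd
  · simp only [dnfCode_formulaCode hφ, freshIndexCode_formulaCode hφ, witEq, formulaCode_bigOr,
      List.map_map]
    exact congrArg bigOrCode (List.map_congr_left fun c hc =>
      cubeWitCode_map_formulaCode fun l hl => isAtomic_of_mem_dnf hc hl)

end WitnessCodes

/-! ### Injectivity of the Gödel numbering -/

section Injective

variable {L : FirstOrder.Language.{0, 0}} [SymbolCoding L]

lemma mul_pair_add_inj {k r a b a' b' : ℕ} (hk : 0 < k) :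
    k * Nat.pair a b + r = k * Nat.pair a' b' + r ↔ a = a' ∧ b = b' := by
  rw [add_left_inj, Nat.mul_right_inj hk.ne', Nat.pair_eq_pair]

lemma sigma_eq_of_pair_eq_pair {S : ℕ → Type*} {α : Type*} {symCode : ∀ {k}, S k → ℕ}
    (hsym : ∀ k, Function.Injective (symCode (k := k))) {entryCode : α → ℕ} {k l : ℕ}
    {R : S k} {Q : S l} {ts : Fin k → α} {us : Fin l → α}
    (hentry : ∀ i u, entryCode (ts i) = entryCode u → ts i = u)
    (h : Nat.pair k (symCode R) = Nat.pair l (symCode Q))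
    (h' : Encodable.encode (List.ofFn fun i => entryCode (ts i)) =
      Encodable.encode (List.ofFn fun i => entryCode (us i))) :
    (⟨k, R, ts⟩ : Σ k, S k × (Fin k → α)) = ⟨l, Q, us⟩ := by
  obtain ⟨rfl, hRQ⟩ := Nat.pair_eq_pair.1 h
  obtain rfl := hsym k hRQ
  have hentries := List.ofFn_injective (Encodable.encode_injective h')
  obtain rfl : ts = us := funext fun i => hentry i _ (congrFun hentries i)
  rfl

lemma termCode_injective (n : ℕ) :
    Function.Injective (termCode : L.Term (ℕ ⊕ Fin n) → ℕ) := by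
  intro t
  induction t with
  | var x =>
    rintro (y | _) h
    · rcases x with i | i <;> rcases y with j | j <;> simp only [termCode] at h
      · rw [show i = j by lia]
      · lia
      · lia
      · rw [show i = j by lia]
    · rcases x with i | i <;> simp only [termCode] at h <;> lia
  | func g ts ih =>
    rintro ((j | j) | ⟨g', us⟩) h <;> simp only [termCode] at h
    · lia
    · lia
    · obtain ⟨hg, hts⟩ := (mul_pair_add_inj (by lia)).1 h
      cases sigma_eq_of_pair_eq_pair SymbolCoding.funCode_injective (fun i _ => @ih i _) hg hts
      rfl

lemma formulaCode_injective {n : ℕ} :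
    Function.Injective (formulaCode : L.BoundedFormula ℕ n → ℕ) := by
  intro φ
  induction φ with
  | falsum => rintro (_ | _ | _ | _ | _) h <;> simp only [formulaCode] at h <;> first | rfl | lia
  | equal t u =>
    rintro (_ | ⟨t', u'⟩ | _ | _ | _) h <;> simp only [formulaCode] at h <;> try lia
    obtain ⟨ht, hu⟩ := (mul_pair_add_inj (by lia)).1 h
    rw [termCode_injective _ ht, termCode_injective _ hu]
  | rel R ts =>
    rintro (_ | _ | ⟨R', us⟩ | _ | _) h <;> simp only [formulaCode] at h <;> try lia
    obtain ⟨hR, hts⟩ := (mul_pair_add_inj (by lia)).1 h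
    cases sigma_eq_of_pair_eq_pair SymbolCoding.relCode_injective
      (fun i _ h => termCode_injective _ h) hR hts
    rfl
  | imp φ ψ ihφ ihψ =>
    rintro (_ | _ | _ | ⟨φ', ψ'⟩ | _) h <;> simp only [formulaCode] at h <;> try lia
    obtain ⟨hφ, hψ⟩ := (mul_pair_add_inj (by lia)).1 h
    rw [ihφ hφ, ihψ hψ]
  | all φ ih =>
    rintro (_ | _ | _ | _ | φ') h <;> simp only [formulaCode] at h <;> try lia
    rw [ih (show formulaCode φ = formulaCode φ' by lia)]

lemma DecidableTheory.computablePred_satisfiable {T : L.Theory} (hT : DecidableTheory T)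
    {α : Type*} [Primcodable α] {φ : α → L.Formula ℕ} (hφ : ∀ a, QF (φ a))
    (hcode : Computable fun a => formulaCode (φ a)) :
    ComputablePred fun a => Satisfiable T (φ a) := by
  obtain ⟨p, hp, hpT⟩ := ComputablePred.computable_iff.1 hT
  refine ComputablePred.computable_iff.2 ⟨fun a => p (formulaCode (φ a)), hp.comp hcode,
    funext fun a => propext ?_⟩
  rw [← congrFun hpT (formulaCode (φ a))]
  exact ⟨fun h => ⟨_, hφ a, rfl, h⟩, fun ⟨_, _, h, hs⟩ => formulaCode_injective h ▸ hs⟩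

end Injective

/-! ### Undecidability of the combination -/

section Count

variable (f : ℕ → Bool) (b : Bool) (k : ℕ)

lemma count_zero : count f b 0 = 0 := by
  simp [count]

lemma count_succ : count f b (k + 1) = count f b k + if f (k + 1) = b then 1 else 0 := by
  simp only [count, Finset.card_filter]
  exact Finset.sum_Icc_succ_top (by lia) _

lemma count_lt_count_succ_iff : count f b k < count f b (k + 1) ↔ f (k + 1) = b := by
  rw [count_succ]
  split_ifs with h <;> simp [h]

lemma count_mono : Monotone (count f b) :=
  monotone_nat_of_le_succ fun k => by rw [count_succ]; exact Nat.le_add_right _ _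

lemma count_true_add_count_false : count f true k + count f false k = k := by
  induction k with
  | zero => rw [count_zero, count_zero]
  | succ k ih => rw [count_succ, count_succ]; cases f (k + 1) <;> simp <;> lia

end Count

section FiniteModels

lemma card_fixSet_true_add_card_fixSet_false (M : Type*) [SigS.Structure M] [Finite M] :
    Nat.card (fixSet M true) + Nat.card (fixSet M false) = Nat.card M := by
  have hcompl : fixSet M false = (fixSet M true)ᶜ := by
    ext x
    simp [fixSet]
  rw [hcompl, Nat.card_coe_set_eq, Nat.card_coe_set_eq, Set.ncard_add_ncard_compl]

lemma models_theoryF_iff_of_finite {M : Type*} [SigS.Structure M] [Nonempty M] [Finite M]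
    {f : ℕ → Bool} : M ⊨ theoryF f ↔ Nat.card (fixSet M true) = count f true (Nat.card M) := by
  have := Fintype.ofFinite M
  have hembed (n : ℕ) (b : Bool) : Nonempty (Fin n ↪ fixSet M b) ↔ n ≤ Nat.card (fixSet M b) := by
    classical
    rw [Function.Embedding.nonempty_iff_card_le, Fintype.card_fin, Nat.card_eq_fintype_card]
  have hequiv (n : ℕ) (b : Bool) : Nonempty (Fin n ≃ fixSet M b) ↔ n = Nat.card (fixSet M b) := by
    refine ⟨fun ⟨e⟩ => ?_, fun h => ⟨(Finite.equivFinOfCardEq h.symm).symm⟩⟩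
    rw [← Nat.card_congr e, Nat.card_fin]
  have hcard := card_fixSet_true_add_card_fixSet_false M
  have hcount := count_true_add_count_false f
  simp only [models_theoryF_iff, hembed, hequiv, Bool.forall_bool]
  constructor
  · intro h
    rcases h (Nat.card M + 1) (by lia) with ⟨hfalse, htrue⟩ | ⟨i, -, hfalse, htrue⟩
    · have := hcount (Nat.card M + 1)
      lia
    · have := hcount (i + 1)
      rw [← htrue, show i + 1 = Nat.card M by lia]
  · intro h k _
    have hM := hcount (Nat.card M)
    rcases lt_or_ge k (Nat.card M) with hlt | hle
    · have htrue := count_mono f true hlt.le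
      have hfalse := count_mono f false hlt.le
      exact Or.inl (by lia)
    · have hpos : 0 < Nat.card M := Nat.card_pos
      refine Or.inr ⟨Nat.card M - 1, by lia, ?_⟩
      rw [Nat.sub_add_cancel hpos]
      lia

end FiniteModels

section Combination

/-- The formula which says that `P n` holds and that the variables `0, …, m - 1` denote distinct
fixed points of `s`. Its satisfiability in `T_f ⊕ T_=` decides whether `m ≤ f₁ n`. -/
def queryFormula (n : ℕ+) (m : ℕ) : (SigS.sum SigP).Formula ℕ :=
  (LHom.sumInr : SigP →ᴸ SigS.sum SigP).onFormula (atomP n) ⊓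
    (bigAnd ((List.range m).map fun i =>
      (LHom.sumInl : SigS →ᴸ SigS.sum SigP).onFormula (fixLit true i)) ⊓ distinctVars 0 m)

lemma qf_queryFormula (n : ℕ+) (m : ℕ) : QF (queryFormula n m) :=
  (BoundedFormula.IsAtomic.isQF (.rel _ _)).inf <|
    (qf_bigAnd (List.forall_mem_map.2 fun _ _ =>
      BoundedFormula.IsAtomic.isQF (.equal _ _))).inf (qf_distinctVars 0 m)

lemma models_combination_iff {L₁ L₂ : FirstOrder.Language.{0, 0}} {T₁ : L₁.Theory}
    {T₂ : L₂.Theory} {M : Type*} [L₁.Structure M] [L₂.Structure M] [(L₁.sum L₂).Structure M]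
    [(LHom.sumInl : L₁ →ᴸ L₁.sum L₂).IsExpansionOn M]
    [(LHom.sumInr : L₂ →ᴸ L₁.sum L₂).IsExpansionOn M] :
    M ⊨ combination T₁ T₂ ↔ M ⊨ T₁ ∧ M ⊨ T₂ := by
  rw [combination, Theory.model_union_iff, LHom.onTheory_model, LHom.onTheory_model]

lemma realize_queryFormula {M : Type*} [SigS.Structure M] [SigP.Structure M]
    [(SigS.sum SigP).Structure M] [(LHom.sumInl : SigS →ᴸ SigS.sum SigP).IsExpansionOn M]
    [(LHom.sumInr : SigP →ᴸ SigS.sum SigP).IsExpansionOn M] {v : ℕ → M} {n : ℕ+} {m : ℕ} :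
    (queryFormula n m).Realize v ↔ HoldsP M n ∧
      (∀ i < m, v i ∈ fixSet M true) ∧ Function.Injective fun i : Fin m => v i := by
  simp only [queryFormula, Formula.realize_inf, LHom.realize_onFormula, realize_atomP,
    realize_bigAnd, List.forall_mem_map, List.mem_range, realize_fixLit, realize_distinctVars,
    zero_add]

lemma le_count_of_satisfiable_queryFormula {f : ℕ → Bool} {n : ℕ+} {m : ℕ}
    (h : Satisfiable (combination (theoryF f) theoryEq) (queryFormula n m)) :
    m ≤ count f true n := by
  obtain ⟨A, hA⟩ := h
  let _ : (SigS.sum SigP).Structure A.Dom := A.str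
  let _ : SigS.Structure A.Dom := (LHom.sumInl : SigS →ᴸ SigS.sum SigP).reduct A.Dom
  let _ : SigP.Structure A.Dom := (LHom.sumInr : SigP →ᴸ SigS.sum SigP).reduct A.Dom
  obtain ⟨hF, hEq⟩ := models_combination_iff.1 A.models
  obtain ⟨hP, hfix, hinj⟩ := realize_queryFormula.1 hA
  obtain ⟨e⟩ := models_theoryEq_iff.1 hEq n hP
  have : Finite A.Dom := Finite.of_equiv _ e
  have : Nonempty A.Dom := ⟨A.val 0⟩
  have hcard : Nat.card A.Dom = n := by rw [← Nat.card_congr e, Nat.card_fin]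
  rw [← hcard, ← models_theoryF_iff_of_finite.1 hF, ← Nat.card_fin m]
  exact Nat.card_le_card_of_injective (fun i : Fin m => (⟨A.val i, hfix i i.2⟩ : fixSet A.Dom true))
    fun i j hij => hinj (congrArg Subtype.val hij)

lemma exists_fixedPoints_eq {n c : ℕ} (hn : 2 ≤ n) :
    ∃ g : Fin n → Fin n, ∀ x, g x = x ↔ (x : ℕ) < c := by
  refine ⟨fun x => if (x : ℕ) < c then x else finRotate n x, fun x => ?_⟩
  have hx : finRotate n x ≠ x := by
    rw [← Equiv.Perm.mem_support, support_finRotate_of_le hn]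
    exact Finset.mem_univ x
  by_cases h : (x : ℕ) < c
  · exact iff_of_true (if_pos h) h
  · exact iff_of_false ((if_neg h).trans_ne hx) h

lemma satisfiable_queryFormula_of_le_count {f : ℕ → Bool} {n : ℕ+} {m : ℕ} (hn : 2 ≤ (n : ℕ))
    (hm : m ≤ count f true n) :
    Satisfiable (combination (theoryF f) theoryEq) (queryFormula n m) := by
  have hle : count f true n ≤ n := (count_true_add_count_false f n).le.trans' (Nat.le_add_right _ _)
  obtain ⟨g, hg⟩ := exists_fixedPoints_eq (c := count f true n) hn
  let _ : SigS.Structure (Fin n) := structureS g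
  let _ : SigP.Structure (Fin n) := structureP _ (· = n)
  have hfix : fixSet (Fin n) true = {x : Fin n | (x : ℕ) < count f true n} :=
    Set.ext fun x => (iff_true_right rfl).trans (hg x)
  have hcard : Nat.card (fixSet (Fin n) true) = count f true n := by
    rw [hfix]
    exact (Nat.card_congr (Fin.castLEquiv hle)).symm.trans (Nat.card_fin _)
  have : NeZero (n : ℕ) := ⟨n.ne_zero⟩
  have hval {i : ℕ} (hi : i < m) : (Fin.ofNat n i : ℕ) = i :=
    Nat.mod_eq_of_lt (hi.trans_le (hm.trans hle))
  refine ⟨⟨Fin n, Fin.ofNat n, models_combination_iff.2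
    ⟨models_theoryF_iff_of_finite.2 (by rw [hcard, Nat.card_fin]),
      models_theoryEq_iff.2 fun k hk => ⟨finCongr hk⟩⟩⟩,
    realize_queryFormula.2 ⟨rfl, fun i hi => ?_, fun i j hij => ?_⟩⟩
  · exact hfix.ge ((hval hi).trans_lt (hi.trans_le hm))
  · have hij' := congrArg Fin.val hij
    rwa [hval i.2, hval j.2, Fin.val_inj] at hij'

/-- The Gödel number of `queryFormula n m`. -/
def queryCode (n m : ℕ) : ℕ :=
  andCode (atomPCode (2 * n + 1)) (andCode
    (bigAndCode ((List.range m).map fun i => equalCode (appCode (3 * i)) (3 * i)))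
    (distinctVarsCode 0 m))

lemma formulaCode_sumInr_atomP {L : FirstOrder.Language.{0, 0}} [SymbolCoding L] (n : ℕ+) :
    formulaCode ((LHom.sumInr : SigP →ᴸ L.sum SigP).onFormula (atomP n)) =
      atomPCode (2 * n + 1) := by
  simp only [atomP, Relations.formula, Relations.boundedFormula, LHom.onFormula,
    LHom.onBoundedFormula, formulaCode, List.ofFn_zero]
  rfl

lemma formulaCode_sumInl_fixLit_true {L : FirstOrder.Language.{0, 0}} [SymbolCoding L] (i : ℕ) :
    formulaCode ((LHom.sumInl : SigS →ᴸ SigS.sum L).onFormula (fixLit true i)) =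
      equalCode (appCode (3 * i)) (3 * i) := by
  have happ : termCode ((LHom.sumInl : SigS →ᴸ SigS.sum L).onTerm
      (symS.apply₁ (Term.var (Sum.inl i)) : SigS.Term (ℕ ⊕ Fin 0))) = appCode (3 * i) := by
    rw [Functions.apply₁, LHom.onTerm, termCode, appCode]
    rfl
  exact (formulaCode_equal _ _).trans (congrArg₂ equalCode happ (termCode_var i))

lemma formulaCode_queryFormula (n : ℕ+) (m : ℕ) :
    formulaCode (queryFormula n m) = queryCode n m := by
  simp only [queryFormula, queryCode, formulaCode_inf, formulaCode_bigAnd, formulaCode_distinctVars,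
    formulaCode_sumInr_atomP, List.map_map, Function.comp_def, formulaCode_sumInl_fixLit_true]

lemma primrec_queryCode : Primrec₂ queryCode := by
  have hvar : Primrec fun p : (ℕ × ℕ) × ℕ => 3 * p.2 :=
    Primrec.nat_mul.comp (Primrec.const 3) Primrec.snd
  exact primrec_andCode.comp
    (primrec_atomPCode.comp (Primrec.nat_double_succ.comp Primrec.fst))
    (primrec_andCode.comp
      (primrec_bigAndCode.comp (Primrec.list_map (Primrec.list_range.comp Primrec.snd)
        (primrec_equalCode.comp (primrec_appCode.comp hvar) hvar)))
      (primrec_distinctVarsCode.comp (Primrec.const 0) Primrec.snd))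

lemma computable_of_computablePred_le {α : Type*} [Primcodable α] {g : α → ℕ}
    (h : ComputablePred fun p : α × ℕ => p.2 ≤ g p.1) : Computable g := by
  have hlt : ComputablePred fun p : α × ℕ => g p.1 < p.2 + 1 :=
    (ComputablePred.computable_of_manyOneReducible ⟨fun p : α × ℕ => (p.1, p.2 + 1),
      Computable.fst.pair (Computable.succ.comp Computable.snd), fun _ => Iff.rfl⟩ h).not.of_eq
      fun _ => not_le
  refine (Computable.find (P := fun a n => g a < n + 1) hlt fun a =>
    ⟨g a, Nat.lt_succ_self _⟩).of_eq fun a => ?_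
  exact (Nat.find_eq_iff _).2 ⟨Nat.lt_succ_self _, fun n hn => by lia⟩

lemma computable_of_computable_add {σ : Type*} [Primcodable σ] {f : ℕ → σ} (k : ℕ)
    (h : Computable fun n => f (n + k)) : Computable f := by
  induction k with
  | zero => exact h
  | succ k ih =>
    refine ih (Computable.of_eq (f := fun n => Nat.casesOn n (f k) fun n => f (n + (k + 1)))
      (Computable.nat_casesOn Computable.id (Computable.const (f k))
        (h.comp Computable.snd).to₂) fun n => ?_)
    cases n with
    | zero => exact congrArg f (Nat.zero_add k).symm
    | succ n => rw [Nat.add_right_comm, Nat.add_assoc]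

theorem computable_of_decidableTheory_combination {f : ℕ → Bool}
    (h : DecidableTheory (combination (theoryF f) theoryEq)) : Computable f := by
  have hquery : Primrec fun p : ℕ × ℕ => queryCode (p.1 + 2) p.2 :=
    primrec_queryCode.comp (Primrec.succ.comp (Primrec.succ.comp Primrec.fst)) Primrec.snd
  have hcode : Computable fun p : ℕ × ℕ => formulaCode (queryFormula (p.1 + 1).succPNat p.2) :=
    hquery.to_comp.of_eq fun p => by rw [formulaCode_queryFormula, Nat.succPNat_coe]
  have hiff (p : ℕ × ℕ) : Satisfiable (combination (theoryF f) theoryEq)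
      (queryFormula (p.1 + 1).succPNat p.2) ↔ p.2 ≤ count f true (p.1 + 2) :=
    ⟨le_count_of_satisfiable_queryFormula, satisfiable_queryFormula_of_le_count
      (n := (p.1 + 1).succPNat) (Nat.le_add_left 2 p.1)⟩
  have hle : ComputablePred fun p : ℕ × ℕ => p.2 ≤ count f true (p.1 + 2) :=
    (h.computablePred_satisfiable (φ := fun p => queryFormula (p.1 + 1).succPNat p.2)
      (fun p => qf_queryFormula _ p.2) hcode).of_eq hiff
  have hcount : Computable fun n => count f true (n + 2) := computable_of_computablePred_le hle
  have hlt : ComputablePred fun n => count f true (n + 2) < count f true (n + 3) :=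
    ComputablePred.computable_of_manyOneReducible
      ⟨fun n => (n + 1, count f true (n + 2) + 1),
        Computable.succ.pair (Computable.succ.comp hcount), fun _ => Iff.rfl⟩ hle
  exact computable_of_computable_add 3 (hlt.decide.of_eq fun n => by simp [count_lt_count_succ_iff])

end Combination

/-! ### Existence of admissible functions -/

section Interleave

variable (g : ℕ → Bool)

/-- The sequence `g 0, ¬g 0, g 1, ¬g 1, …`, indexed from `1`; every pair `2m + 1, 2m + 2` of
indices contributes one value `true` and one value `false`. -/
def interleave (n : ℕ) : Bool := if n % 2 = 1 then g (n / 2) else !g (n / 2 - 1)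

lemma interleave_two_mul_add_one (m : ℕ) : interleave g (2 * m + 1) = g m := by
  rw [interleave, if_pos (by lia), show (2 * m + 1) / 2 = m by lia]

lemma interleave_two_mul_add_two (m : ℕ) : interleave g (2 * m + 2) = !g m := by
  rw [interleave, if_neg (by lia), show (2 * m + 2) / 2 - 1 = m by lia]

lemma count_interleave_two_mul (b : Bool) (m : ℕ) : count (interleave g) b (2 * m) = m := by
  induction m with
  | zero => exact count_zero _ _
  | succ m ih =>
    rw [show 2 * (m + 1) = 2 * m + 1 + 1 by ring, count_succ, count_succ, ih,
      interleave_two_mul_add_one, interleave_two_mul_add_two]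
    cases b <;> cases g m <;> rfl

variable {g}

lemma isAdmissible_interleave (h0 : g 0 = true) (hg : ¬ Computable g) :
    IsAdmissible (interleave g) where
  one := (interleave_two_mul_add_one g 0).trans h0
  balanced k hk := by
    obtain ⟨j, rfl⟩ := Nat.exists_eq_add_of_le' hk
    rw [pow_succ', count_interleave_two_mul, count_interleave_two_mul]
  not_computable h := hg <|
    (h.comp Primrec.nat_double_succ.to_comp).of_eq (interleave_two_mul_add_one g)

end Interleave

lemma exists_not_computable : ∃ g : ℕ → Bool, ¬ Computable g := by
  classical
  refine ⟨fun n => decide ((Denumerable.ofNat Nat.Partrec.Code n).eval 0).Dom, fun h => ?_⟩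
  refine ComputablePred.halting_problem 0 ((h.comp Computable.encode).computablePred.of_eq ?_)
  simp

theorem exists_isAdmissible : ∃ f : ℕ → Bool, IsAdmissible f := by
  obtain ⟨g, hg⟩ := exists_not_computable
  let g' : ℕ → Bool := fun n => n.casesOn true g
  exact ⟨interleave g', isAdmissible_interleave rfl fun h => hg (h.comp Computable.succ)⟩

end TheoryCombination

open TheoryCombination in
theorem mainTheorem4_general :
    (∃ f : ℕ → Bool, IsAdmissible f) ∧
    DecidableTheory theoryEq ∧
    StronglyFinitelyWitnessable theoryEq ∧
    ComputableOnQF witEq ∧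
    IsStrongWitness theoryEq witEq ∧
    ¬ Smooth theoryEq ∧
    ∀ f : ℕ → Bool, DecidableTheory (theoryF f) ∧
      (DecidableTheory (combination (theoryF f) theoryEq) → Computable f) :=
  ⟨exists_isAdmissible, decidableTheory_theoryEq,
    ⟨_, computableOnQF_witEq, isStrongWitness_witEq⟩, computableOnQF_witEq, isStrongWitness_witEq,
    not_smooth_theoryEq, fun f =>
      ⟨decidableTheory_theoryF f, computable_of_decidableTheory_combination⟩⟩

theorem mainTheorem4 :
    (∃ f : ℕ → Bool, TheoryCombination.IsAdmissible f) ∧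
    TheoryCombination.DecidableTheory TheoryCombination.theoryEq ∧
    TheoryCombination.StronglyFinitelyWitnessable TheoryCombination.theoryEq ∧
    TheoryCombination.ComputableOnQF TheoryCombination.witEq ∧
    TheoryCombination.IsStrongWitness TheoryCombination.theoryEq TheoryCombination.witEq ∧
    ¬ TheoryCombination.Smooth TheoryCombination.theoryEq ∧
    ∀ f : ℕ → Bool, TheoryCombination.IsAdmissible f →
      TheoryCombination.DecidableTheory (TheoryCombination.theoryF f) ∧
      ¬ TheoryCombination.DecidableTheory
        (TheoryCombination.combination (TheoryCombination.theoryF f) TheoryCombination.theoryEq) :=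
  let ⟨hf, hdec, hsfw, hcomp, hwit, hsmooth, hcomb⟩ := mainTheorem4_general
  ⟨hf, hdec, hsfw, hcomp, hwit, hsmooth, fun f hf =>
    ⟨(hcomb f).1, fun h => hf.not_computable ((hcomb f).2 h)⟩⟩
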